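/- Throughout, an algebraic circuit over a field $\mathbb{F}$ in the variables $x_1,\dots,x_n$ is a finite directed acyclic graph (parallel edges allowed) whose leaves are labelled by variables or by arbitrary constants from $\mathbb{F}$, whose other nodes are addition and multiplication gates of arbitrary fan-in and fan-out, and which has a designated output node; its size is the number of its nodes plus the number of its edges. For a polynomial $p$, $\mathrm{size}(p)$ is the least size of a circuit computing $p$. For a nonzero polynomial $p = c\prod_i p_i^{e_i}$ with $c$ a nonzero constant, the $p_i$ pairwise non-associate irreducible polynomials and $e_i>0$, the radical (squarefree part) is $\mathrm{rad}(p)=\prod_i p_i$ (well defined up to a nonzero constant). **Theorem.** There is a univariate polynomial $P$ with natural number coefficients such that the following holds for every algebraically closed field $\mathbb{F}$ of characteristic $0$ and all $n, s\in\mathbb{N}$. Let $f,u_0,u_1\in\mathbb{F}[x_1,\dots,x_n]$ with $f\neq 0$, $f=u_0u_1$ and $\mathrm{size}(f)+\mathrm{size}(u_0)\le s$. Then every factor $g$ of $u_1$ is computed by an algebraic circuit over $\mathbb{F}$ of size at most $P\bigl(s+\deg(\mathrm{rad}(u_1))\bigr)$. In particular, the bound does not depend on the multiplicities of the irreducible factors.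 -/

import Mathlib

/-- A gate of an algebraic circuit over `F` in the variables `x₀, …, xₙ₋₁`, placed above `k` nodes:
an input variable, a field constant, or an addition or multiplication gate together with the list
of its inputs. Fan-in is unbounded, and the same node may be used several times as an input (parallel
edges), so that `y * y` is available. A gate without inputs computes the empty sum `0` or the empty
product `1`, at the cost of a constant. -/
inductive CircuitGate (F : Type*) (n k : ℕ) where
  | var (i : Fin n)
  | const (c : F)
  | add (inputs : List (Fin k))
  | mul (inputs : List (Fin k))

namespace CircuitGate

/-- The number of edges entering the gate. -/
def fanIn {F : Type*} {n k : ℕ} : CircuitGate F n k → ℕ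
  | var _ => 0
  | const _ => 0
  | add inputs => inputs.length
  | mul inputs => inputs.length

/-- The polynomial computed at the gate, given the polynomials `v` computed at the nodes below. -/
noncomputable def value {F : Type*} [Field F] {n k : ℕ} (v : Fin k → MvPolynomial (Fin n) F) :
    CircuitGate F n k → MvPolynomial (Fin n) F
  | var i => MvPolynomial.X i
  | const c => MvPolynomial.C c
  | add inputs => (inputs.map v).sum
  | mul inputs => (inputs.map v).prod

end CircuitGate

/-- An acyclic arrangement of `m` gates, listed in a topological order of the underlying directed
acyclic multigraph: the inputs of every gate are among the earlier nodes, which may be reused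
arbitrarily often (unbounded fan-out). -/
inductive CircuitNodes (F : Type*) (n : ℕ) : ℕ → Type _ where
  | nil : CircuitNodes F n 0
  | snoc {m : ℕ} (C : CircuitNodes F n m) (g : CircuitGate F n m) : CircuitNodes F n (m + 1)

namespace CircuitNodes

/-- The polynomial computed at each node. -/
noncomputable def value {F : Type*} [Field F] {n : ℕ} :
    {m : ℕ} → CircuitNodes F n m → Fin m → MvPolynomial (Fin n) F
  | _, nil => Fin.elim0
  | _, snoc C g => Fin.snoc (α := fun _ => MvPolynomial (Fin n) F) C.value (g.value C.value)

/-- The total number of edges. -/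
def numEdges {F : Type*} {n : ℕ} : {m : ℕ} → CircuitNodes F n m → ℕ
  | _, nil => 0
  | _, snoc C g => C.numEdges + g.fanIn

end CircuitNodes

/-- An algebraic circuit over `F` in `n` variables: a directed acyclic graph of gates with a
distinguished output node. -/
structure AlgCircuit (F : Type*) (n : ℕ) where
  /-- the number of nodes -/
  numNodes : ℕ
  /-- the gates -/
  nodes : CircuitNodes F n numNodes
  /-- the output node -/
  output : Fin numNodes

namespace AlgCircuit

/-- The polynomial computed by the circuit. -/
noncomputable def eval {F : Type*} [Field F] {n : ℕ} (C : AlgCircuit F n) :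
    MvPolynomial (Fin n) F :=
  C.nodes.value C.output

/-- The size of a circuit: the number of its nodes and edges. -/
def size {F : Type*} {n : ℕ} (C : AlgCircuit F n) : ℕ :=
  C.numNodes + C.nodes.numEdges

end AlgCircuit

/-- The circuit size of a polynomial: the least size of an algebraic circuit that computes it. -/
noncomputable def circuitSize {F : Type*} [Field F] {n : ℕ} (p : MvPolynomial (Fin n) F) : ℕ :=
  sInf {t : ℕ | ∃ C : AlgCircuit F n, C.eval = p ∧ C.size = t}

/-- The nodes of two circuits side by side; the values of both are still available. -/
theorem CircuitNodes.exists_append {F : Type*} [Field F] {n m₁ m₂ : ℕ} (C : CircuitNodes F n m₁)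
    (D : CircuitNodes F n m₂) : ∃ (m : ℕ) (E : CircuitNodes F n m),
      (∀ i, ∃ j, E.value j = C.value i) ∧ (∀ i, ∃ j, E.value j = D.value i) := by
  induction D with
  | nil => exact ⟨m₁, C, fun i => ⟨i, rfl⟩, fun i => i.elim0⟩
  | snoc D g ih =>
    obtain ⟨m, E, hC, hD⟩ := ih
    choose φ hφ using hD
    have hold : ∀ (g' : CircuitGate F n m) (j : Fin m),
        (E.snoc g').value j.castSucc = E.value j := fun g' j => by simp [CircuitNodes.value]
    have hnew : ∀ g' : CircuitGate F n m,
        (E.snoc g').value (Fin.last m) = g'.value E.value := fun g' => by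
      simp [CircuitNodes.value]
    have hmap : ∀ l : List (Fin _), (l.map φ).map E.value = l.map D.value := fun l => by
      simp [hφ]
    obtain ⟨g', hg'⟩ : ∃ g' : CircuitGate F n m, g'.value E.value = g.value D.value := by
      cases g with
      | var i => exact ⟨.var i, rfl⟩
      | const c => exact ⟨.const c, rfl⟩
      | add l => exact ⟨.add (l.map φ), by simp only [CircuitGate.value, hmap]⟩
      | mul l => exact ⟨.mul (l.map φ), by simp only [CircuitGate.value, hmap]⟩
    refine ⟨m + 1, E.snoc g', fun i => ?_, fun i => ?_⟩
    · obtain ⟨j, hj⟩ := hC i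
      exact ⟨j.castSucc, by rw [hold, hj]⟩
    · refine Fin.lastCases ?_ (fun i => ?_) i
      · exact ⟨Fin.last m, by rw [hnew, hg']; simp [CircuitNodes.value]⟩
      · exact ⟨(φ i).castSucc, by rw [hold, hφ]; simp [CircuitNodes.value]⟩

/-- Every polynomial is computed by some circuit. -/
theorem AlgCircuit.exists_eval_eq {F : Type*} [Field F] {n : ℕ} (p : MvPolynomial (Fin n) F) :
    ∃ C : AlgCircuit F n, C.eval = p := by
  have key : ∀ C D : AlgCircuit F n, (∃ E : AlgCircuit F n, E.eval = C.eval + D.eval) ∧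
      (∃ E : AlgCircuit F n, E.eval = C.eval * D.eval) := by
    intro C D
    obtain ⟨m, E, hC, hD⟩ := CircuitNodes.exists_append C.nodes D.nodes
    obtain ⟨i, hi⟩ := hC C.output
    obtain ⟨j, hj⟩ := hD D.output
    exact ⟨⟨⟨m + 1, E.snoc (.add [i, j]), Fin.last m⟩, by
        simp [AlgCircuit.eval, CircuitNodes.value, CircuitGate.value, hi, hj]⟩,
      ⟨⟨m + 1, E.snoc (.mul [i, j]), Fin.last m⟩, by
        simp [AlgCircuit.eval, CircuitNodes.value, CircuitGate.value, hi, hj]⟩⟩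
  induction p using MvPolynomial.induction_on with
  | C c => exact ⟨⟨1, CircuitNodes.nil.snoc (.const c), 0⟩, rfl⟩
  | add p q hp hq =>
    obtain ⟨C, rfl⟩ := hp
    obtain ⟨D, rfl⟩ := hq
    exact (key C D).1
  | mul_X p i hp =>
    obtain ⟨C, rfl⟩ := hp
    obtain ⟨E, hE⟩ := (key C ⟨1, CircuitNodes.nil.snoc (.var i), 0⟩).2
    exact ⟨E, hE⟩

/-- The minimum in the definition of `circuitSize` is attained. -/
theorem exists_circuit_size_eq_circuitSize {F : Type*} [Field F] {n : ℕ}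
    (p : MvPolynomial (Fin n) F) :
    ∃ C : AlgCircuit F n, C.eval = p ∧ C.size = circuitSize p := by
  obtain ⟨C, hC⟩ := AlgCircuit.exists_eval_eq p
  exact Nat.sInf_mem (s := {t : ℕ | ∃ C : AlgCircuit F n, C.eval = p ∧ C.size = t})
    ⟨C.size, C, hC, rfl⟩

/-- The radical (squarefree part) of a polynomial: the product of its distinct irreducible factors,
one from each class of associates. The choice of representatives affects it only by a nonzero
constant. -/
noncomputable def polyRad {F : Type*} [Field F] {n : ℕ} (p : MvPolynomial (Fin n) F) :
    MvPolynomial (Fin n) F :=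
  letI : StrongNormalizationMonoid (MvPolynomial (Fin n) F) :=
    UniqueFactorizationMonoid.strongNormalizationMonoid
  UniqueFactorizationMonoid.radical p

/-! Let `R` be the radical of `u₁`. For a directional derivative `D` one has `D u₁ / u₁ = A / R`
with `deg A < deg R`: a logarithmic derivative retains the multiplicities only as scalars. The same
fraction is `N / M` with `N = D f · u₀ - f · D u₀` and `M = f · u₀`, which have small circuits
although their degrees may be exponential. If `P` is an irreducible factor and `R = P Q`, then `P Q
N = A M`, where the unknowns `P`, `Q`, `A` have degree at most `d = deg R`.

The unknowns are found by a Hensel-type lifting. Substitute `β + y α + t (x - β)` for `x` and expand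
in `t`. At order `0` only univariate polynomials over `F` remain, whose coefficients are hardwired
as constants. At order `k ≥ 1` the identity, sampled at `2 d` values of `y`, is a linear system for
the order `k` parts of `P`, `Q`, `A`, with a right-hand side known from lower orders. Its matrix has
entries in `F` and involves order `0` data only. It is injective because, for generic `α` and `β`,
`R` restricted to the line `β + y α` is separable, so that `P` is coprime to `Q` and `R` to `A`
there (`exists_ne_zero_forall_separable_lineHom`, `exists_logDeriv_numerator`,
`Polynomial.eq_zero_of_eval_mul_eq`, `exists_lift_coefficients`).

Of `N` and `M` only the coefficients up to order `d` in `t` are needed; truncated arithmetic along a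
circuit yields them at a cost independent of the degrees (`RelCost.coeffs_segmentHom`). At `t = 1`,
`y = 0` the parts add up to `P`. A general factor is a product of powers of such `P`, with exponents
at most `2 ^ s`, so repeated squaring suffices (`RelCost.divisor`). -/

section

variable {F : Type*} [Field F] {n : ℕ}

/-! ### Relative circuit cost and simulation of circuits -/

/-- `RelCost S T t`: every arrangement of gates which computes all polynomials in `S` can be extended
by gates and edges of total number at most `t` so as to compute all polynomials in `T`. -/
def RelCost (S T : Set (MvPolynomial (Fin n) F)) (t : ℕ) : Prop :=
  ∀ (m : ℕ) (C : CircuitNodes F n m), S ⊆ Set.range C.value →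
    ∃ (m' : ℕ) (C' : CircuitNodes F n m'), Set.range C.value ⊆ Set.range C'.value ∧
      T ⊆ Set.range C'.value ∧ m' + C'.numEdges ≤ m + C.numEdges + t

theorem CircuitNodes.range_value_snoc {m : ℕ} (C : CircuitNodes F n m) (g : CircuitGate F n m) :
    Set.range (C.snoc g).value = insert (g.value C.value) (Set.range C.value) := by
  simp only [CircuitNodes.value]
  ext p
  constructor
  · rintro ⟨i, rfl⟩
    refine Fin.lastCases ?_ (fun i => ?_) i
    · simp
    · simp
  · rintro (rfl | ⟨i, rfl⟩)
    · exact ⟨Fin.last m, by simp⟩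
    · exact ⟨i.castSucc, by simp⟩

namespace RelCost

variable {S S' T T' U : Set (MvPolynomial (Fin n) F)} {a b t : ℕ}

theorem mono (h : RelCost S T a) (hS : S ⊆ S') (hT : T' ⊆ T) (hab : a ≤ b) :
    RelCost S' T' b := by
  intro m C hC
  obtain ⟨m', C', h1, h2, h3⟩ := h m C (hS.trans hC)
  exact ⟨m', C', h1, hT.trans h2, by omega⟩

theorem le (h : RelCost S T a) (hab : a ≤ b) : RelCost S T b :=
  h.mono subset_rfl subset_rfl hab

theorem of_subset (h : T ⊆ S) : RelCost S T 0 :=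
  fun m C hC => ⟨m, C, subset_rfl, h.trans hC, le_rfl⟩

/-- Extending an arrangement keeps all its old values, so intermediate results are shared and costs
add up instead of multiplying. -/
theorem trans (h : RelCost S T a) (h' : RelCost (S ∪ T) U b) : RelCost S (T ∪ U) (a + b) := by
  intro m C hC
  obtain ⟨m', C', h1, h2, h3⟩ := h m C hC
  obtain ⟨m'', C'', h4, h5, h6⟩ := h' m' C' (Set.union_subset (hC.trans h1) h2)
  exact ⟨m'', C'', h1.trans h4, Set.union_subset (h2.trans h4) h5, by omega⟩

theorem comp (h : RelCost S T a) (h' : RelCost (S ∪ T) U b) : RelCost S U (a + b) :=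
  (h.trans h').mono subset_rfl Set.subset_union_right le_rfl

theorem union (h : RelCost S T a) (h' : RelCost S U b) : RelCost S (T ∪ U) (a + b) :=
  h.trans (h'.mono Set.subset_union_left subset_rfl le_rfl)

theorem biUnion {ι : Type*} (s : Finset ι) (T : ι → Set (MvPolynomial (Fin n) F))
    (h : ∀ i ∈ s, RelCost S (T i) a) : RelCost S (⋃ i ∈ s, T i) (s.card * a) := by
  classical
  induction s using Finset.induction_on with
  | empty => exact (of_subset (Set.empty_subset S)).mono subset_rfl (by simp) (by simp)
  | insert i s hi ih =>
    refine ((h i (by simp)).union (ih fun j hj => h j (by simp [hj]))).mono subset_rfl ?_ ?_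
    · simp
    · rw [Finset.card_insert_of_notMem hi]
      exact le_of_eq (by ring)

theorem image {ι : Type*} (s : Finset ι) (q : ι → MvPolynomial (Fin n) F)
    (h : ∀ i ∈ s, RelCost S {q i} a) : RelCost S (q '' s) (s.card * a) :=
  (biUnion s (fun i => {q i}) h).mono subset_rfl (by rintro _ ⟨i, hi, rfl⟩; simpa using ⟨i, hi, rfl⟩)
    le_rfl

theorem const (c : F) : RelCost S {MvPolynomial.C c} 1 := by
  intro m C _
  refine ⟨m + 1, C.snoc (.const c), ?_, ?_, ?_⟩
  · rw [CircuitNodes.range_value_snoc]; exact Set.subset_insert _ _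
  · rw [CircuitNodes.range_value_snoc]; simp [CircuitGate.value]
  · simp only [CircuitNodes.numEdges, CircuitGate.fanIn]; omega

theorem var (i : Fin n) : RelCost S {(MvPolynomial.X i : MvPolynomial (Fin n) F)} 1 := by
  intro m C _
  refine ⟨m + 1, C.snoc (.var i), ?_, ?_, ?_⟩
  · rw [CircuitNodes.range_value_snoc]; exact Set.subset_insert _ _
  · rw [CircuitNodes.range_value_snoc]; simp [CircuitGate.value]
  · simp only [CircuitNodes.numEdges, CircuitGate.fanIn]; omega

theorem sum {ι : Type*} (s : Finset ι) (q : ι → MvPolynomial (Fin n) F) (h : ∀ i ∈ s, q i ∈ S) :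
    RelCost S {∑ i ∈ s, q i} (1 + s.card) := by
  intro m C hC
  choose φ hφ using fun i : s => hC (h i i.2)
  refine ⟨m + 1, C.snoc (.add (s.attach.toList.map φ)), ?_, ?_, ?_⟩
  · rw [CircuitNodes.range_value_snoc]; exact Set.subset_insert _ _
  · rw [CircuitNodes.range_value_snoc]
    simp only [CircuitGate.value, List.map_map, Set.singleton_subset_iff]
    left
    rw [← Finset.sum_attach, ← Finset.sum_map_toList]
    congr 2
    funext i
    simp [hφ]
  · simp only [CircuitNodes.numEdges, CircuitGate.fanIn, List.length_map, Finset.length_toList,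
      Finset.card_attach]; omega

theorem prod {ι : Type*} (s : Finset ι) (q : ι → MvPolynomial (Fin n) F) (h : ∀ i ∈ s, q i ∈ S) :
    RelCost S {∏ i ∈ s, q i} (1 + s.card) := by
  intro m C hC
  choose φ hφ using fun i : s => hC (h i i.2)
  refine ⟨m + 1, C.snoc (.mul (s.attach.toList.map φ)), ?_, ?_, ?_⟩
  · rw [CircuitNodes.range_value_snoc]; exact Set.subset_insert _ _
  · rw [CircuitNodes.range_value_snoc]
    simp only [CircuitGate.value, List.map_map, Set.singleton_subset_iff]
    left
    rw [← Finset.prod_attach, ← Finset.prod_map_toList]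
    congr 2
    funext i
    simp [hφ]
  · simp only [CircuitNodes.numEdges, CircuitGate.fanIn, List.length_map, Finset.length_toList,
      Finset.card_attach]; omega

theorem add {p q : MvPolynomial (Fin n) F} (hp : p ∈ S) (hq : q ∈ S) : RelCost S {p + q} 3 := by
  simpa using sum (S := S) (Finset.univ : Finset (Fin 2)) ![p, q] (by
    intro i _; fin_cases i <;> simpa)

theorem mul {p q : MvPolynomial (Fin n) F} (hp : p ∈ S) (hq : q ∈ S) : RelCost S {p * q} 3 := by
  simpa using prod (S := S) (Finset.univ : Finset (Fin 2)) ![p, q] (by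
    intro i _; fin_cases i <;> simpa)

theorem sum_mul {ι : Type*} (s : Finset ι) (p q : ι → MvPolynomial (Fin n) F)
    (hp : ∀ i ∈ s, p i ∈ S) (hq : ∀ i ∈ s, q i ∈ S) :
    RelCost S {∑ i ∈ s, p i * q i} (4 * s.card + 1) :=
  ((image s (fun i => p i * q i) fun i hi => mul (hp i hi) (hq i hi)).comp
    (sum s _ fun i hi => Or.inr ⟨i, hi, rfl⟩)).le (by omega)

theorem mul_add_mul {p q p' q' : MvPolynomial (Fin n) F} (hp : p ∈ S) (hq : q ∈ S) (hp' : p' ∈ S)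
    (hq' : q' ∈ S) : RelCost S {p * q + p' * q'} 9 := by
  simpa using sum_mul (S := S) (Finset.univ : Finset (Fin 2)) ![p, p'] ![q, q']
    (by intro i _; fin_cases i <;> simpa) (by intro i _; fin_cases i <;> simpa)

theorem linearCombination {ι : Type*} (s : Finset ι) (c : ι → F) (q : ι → MvPolynomial (Fin n) F)
    (hq : ∀ i ∈ s, q i ∈ S) :
    RelCost S {∑ i ∈ s, MvPolynomial.C (c i) * q i} (5 * s.card + 1) :=
  ((image s (fun i => MvPolynomial.C (c i)) fun i _ => const (c i)).comp
    (sum_mul s _ q (fun i hi => Or.inr ⟨i, hi, rfl⟩) fun i hi => Or.inl (hq i hi))).le (by omega)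

theorem sub {p q : MvPolynomial (Fin n) F} (hp : p ∈ S) (hq : q ∈ S) : RelCost S {p - q} 11 := by
  have := linearCombination (S := S) (Finset.univ : Finset (Fin 2)) ![1, -1] ![p, q] (by
    intro i _; fin_cases i <;> simpa)
  simpa [sub_eq_add_neg] using this

/-- Repeated squaring, with `k` bounding the bit length of `e`. Multiplicities can be exponential in
the circuit size, so a logarithmic cost is essential. -/
theorem pow (p : MvPolynomial (Fin n) F) (k e : ℕ) (he : e < 2 ^ k) (hp : p ∈ S) :
    RelCost S {p ^ e} (6 * k + 1) := by
  induction k generalizing e with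
  | zero =>
    obtain rfl : e = 0 := by simpa using he
    simpa using (const (S := S) (1 : F))
  | succ k ih =>
    have h1 := ih (e / 2) (by rw [pow_succ] at he; omega)
    have h2 : RelCost (S ∪ {p ^ (e / 2)}) {p ^ (e / 2) * p ^ (e / 2)} 3 :=
      mul (by simp) (by simp)
    have h3 := h1.comp h2
    rw [← pow_add] at h3
    rcases Nat.even_or_odd' e with ⟨j, rfl | rfl⟩
    · rw [show 2 * j / 2 + 2 * j / 2 = 2 * j by omega] at h3
      exact h3.le (by omega)
    · rw [show (2 * j + 1) / 2 + (2 * j + 1) / 2 = 2 * j by omega] at h3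
      refine (h3.comp (pow_succ p (2 * j) ▸ mul (by simp) (by simp [hp]))).le (by omega)

theorem exists_nodes (h : RelCost ∅ T t) :
    ∃ (m : ℕ) (C : CircuitNodes F n m), T ⊆ Set.range C.value ∧ m + C.numEdges ≤ t := by
  obtain ⟨m, C, _, h2, h3⟩ := h 0 .nil (Set.empty_subset _)
  exact ⟨m, C, h2, by simpa [CircuitNodes.numEdges] using h3⟩

theorem exists_circuit {p : MvPolynomial (Fin n) F} (h : RelCost ∅ {p} t) :
    ∃ C : AlgCircuit F n, C.eval = p ∧ C.size ≤ t := by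
  obtain ⟨m, C, h1, h2⟩ := h.exists_nodes
  obtain ⟨i, hi⟩ := h1 rfl
  exact ⟨⟨m, C, i⟩, hi, h2⟩

/-- Gate-by-gate simulation: if `Φ` can be computed at inputs and propagated through sums and
products at cost `B`, then it can be computed at all nodes of a circuit at `B` times its size. -/
theorem simulate (Φ : MvPolynomial (Fin n) F → Set (MvPolynomial (Fin n) F)) (B : ℕ)
    (hX : ∀ i, RelCost ∅ (Φ (MvPolynomial.X i)) B) (hC : ∀ c, RelCost ∅ (Φ (MvPolynomial.C c)) B)
    (hadd : ∀ p q, RelCost (Φ p ∪ Φ q) (Φ (p + q)) B)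
    (hmul : ∀ p q, RelCost (Φ p ∪ Φ q) (Φ (p * q)) B) {m : ℕ} (C : CircuitNodes F n m) :
    RelCost ∅ (⋃ i, Φ (C.value i)) (B * (m + C.numEdges)) := by
  induction C with
  | nil => exact (of_subset (Set.empty_subset ∅)).mono subset_rfl (by simp) (by simp)
  | @snoc m C g ih =>
    have hsum : ∀ l : List (Fin m),
        RelCost (⋃ i, Φ (C.value i)) (Φ (l.map C.value).sum) (B * (1 + l.length)) := by
      intro l
      induction l with
      | nil => exact (MvPolynomial.C_0 (R := F) (σ := Fin n) ▸ hC 0 :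
          RelCost ∅ (Φ 0) B).mono (Set.empty_subset _) (by simp) (by simp)
      | cons i l ihl =>
        rw [List.map_cons, List.sum_cons]
        refine (ihl.comp ((hadd _ _).mono ?_ subset_rfl le_rfl)).le ?_
        · exact Set.union_subset_union_left _ (Set.subset_iUnion (fun i => Φ (C.value i)) i)
        · simp only [List.length_cons]; exact le_of_eq (by ring)
    have hprod : ∀ l : List (Fin m),
        RelCost (⋃ i, Φ (C.value i)) (Φ (l.map C.value).prod) (B * (1 + l.length)) := by
      intro l
      induction l with
      | nil => exact (MvPolynomial.C_1 (R := F) (σ := Fin n) ▸ hC 1 :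
          RelCost ∅ (Φ 1) B).mono (Set.empty_subset _) (by simp) (by simp)
      | cons i l ihl =>
        rw [List.map_cons, List.prod_cons]
        refine (ihl.comp ((hmul _ _).mono ?_ subset_rfl le_rfl)).le ?_
        · exact Set.union_subset_union_left _ (Set.subset_iUnion (fun i => Φ (C.value i)) i)
        · simp only [List.length_cons]; exact le_of_eq (by ring)
    have hg : RelCost (⋃ i, Φ (C.value i)) (Φ (g.value C.value)) (B * (1 + g.fanIn)) := by
      cases g with
      | var i => exact (hX i).mono (Set.empty_subset _) subset_rfl (by simp [CircuitGate.fanIn])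
      | const c => exact (hC c).mono (Set.empty_subset _) subset_rfl (by simp [CircuitGate.fanIn])
      | add l => exact hsum l
      | mul l => exact hprod l
    refine (ih.trans (hg.mono Set.subset_union_right subset_rfl le_rfl)).mono subset_rfl ?_ ?_
    · refine Set.iUnion_subset fun i => ?_
      have hi : (C.snoc g).value i ∈ Set.range (C.snoc g).value := ⟨i, rfl⟩
      rw [CircuitNodes.range_value_snoc] at hi
      rcases hi with hi | ⟨j, hj⟩
      · rw [hi]; exact Set.subset_union_right
      · rw [← hj]
        exact (Set.subset_iUnion (fun i => Φ (C.value i)) j).trans Set.subset_union_left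
    · simp only [CircuitNodes.numEdges]
      exact le_of_eq (by ring)

theorem simulate_set {Φ : MvPolynomial (Fin n) F → Set (MvPolynomial (Fin n) F)} {B : ℕ}
    (hX : ∀ i, RelCost ∅ (Φ (MvPolynomial.X i)) B) (hC : ∀ c, RelCost ∅ (Φ (MvPolynomial.C c)) B)
    (hadd : ∀ p q, RelCost (Φ p ∪ Φ q) (Φ (p + q)) B)
    (hmul : ∀ p q, RelCost (Φ p ∪ Φ q) (Φ (p * q)) B) (h : RelCost ∅ T t) :
    RelCost ∅ (⋃ p ∈ T, Φ p) (B * t) := by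
  obtain ⟨m, C, h1, h2⟩ := h.exists_nodes
  refine (simulate Φ B hX hC hadd hmul C).mono subset_rfl ?_ (Nat.mul_le_mul_left B h2)
  refine Set.iUnion₂_subset fun p hp => ?_
  obtain ⟨i, rfl⟩ := h1 hp
  exact Set.subset_iUnion (fun i => Φ (C.value i)) i

theorem simulate_of_circuitSize_le {Φ : MvPolynomial (Fin n) F → Set (MvPolynomial (Fin n) F)}
    {B : ℕ} (hX : ∀ i, RelCost ∅ (Φ (MvPolynomial.X i)) B)
    (hC : ∀ c, RelCost ∅ (Φ (MvPolynomial.C c)) B)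
    (hadd : ∀ p q, RelCost (Φ p ∪ Φ q) (Φ (p + q)) B)
    (hmul : ∀ p q, RelCost (Φ p ∪ Φ q) (Φ (p * q)) B) {p : MvPolynomial (Fin n) F} {s : ℕ}
    (h : circuitSize p ≤ s) : RelCost ∅ (Φ p) (B * s) := by
  obtain ⟨C, rfl, hs⟩ := exists_circuit_size_eq_circuitSize p
  exact (simulate Φ B hX hC hadd hmul C.nodes).mono subset_rfl
    (Set.subset_iUnion (fun i => Φ (C.nodes.value i)) C.output)
    (Nat.mul_le_mul_left B (hs.trans_le h))

/-- A polynomial and its image under a derivation that is constant on the variables. -/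
theorem derivation (α : Fin n → F) {p : MvPolynomial (Fin n) F} {s : ℕ} (h : circuitSize p ≤ s) :
    RelCost ∅ {p, MvPolynomial.mkDerivation F (fun i => MvPolynomial.C (α i)) p} (12 * s) := by
  refine simulate_of_circuitSize_le
    (Φ := fun p => {p, MvPolynomial.mkDerivation F (fun i => MvPolynomial.C (α i)) p})
    (fun i => ?_) (fun c => ?_) (fun p q => ?_) (fun p q => ?_) h
  · rw [MvPolynomial.mkDerivation_X]
    exact ((var i).union (const (α i))).le (by norm_num)
  · rw [show MvPolynomial.C c = algebraMap F (MvPolynomial (Fin n) F) c from rfl,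
      Derivation.map_algebraMap, ← MvPolynomial.C_0]
    exact ((const c).union (const 0)).le (by norm_num)
  · rw [map_add]
    exact ((add (by simp) (by simp)).union (add (by simp) (by simp))).le (by norm_num)
  · rw [Derivation.leibniz, smul_eq_mul, smul_eq_mul]
    exact ((mul (by simp) (by simp)).union
      (mul_add_mul (by simp) (by simp) (by simp) (by simp))).le (by norm_num)

end RelCost

/-! ### Degree is at most exponential in size -/

/-- A product gate with `l` inputs raises the degree bound by a factor `l ≤ 2 ^ l`, which is paid
for by its `l` edges; a sum gate does not raise it. -/
theorem CircuitNodes.totalDegree_value_le {m : ℕ} (C : CircuitNodes F n m) (i : Fin m) :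
    (C.value i).totalDegree ≤ 2 ^ (m + C.numEdges) := by
  induction C with
  | nil => exact i.elim0
  | @snoc m C g ih =>
    have hi : (C.snoc g).value i ∈ Set.range (C.snoc g).value := ⟨i, rfl⟩
    rw [CircuitNodes.range_value_snoc] at hi
    simp only [CircuitNodes.numEdges]
    rcases hi with hi | ⟨j, hj⟩
    · rw [hi]
      clear hi
      cases g with
      | var i => simp [CircuitGate.value, MvPolynomial.totalDegree_X, Nat.one_le_two_pow]
      | const c => simp [CircuitGate.value]
      | add l =>
        have : ((l.map C.value).sum).totalDegree ≤ 2 ^ (m + C.numEdges) := by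
          induction l with
          | nil => simp
          | cons k l ihl =>
            rw [List.map_cons, List.sum_cons]
            exact (MvPolynomial.totalDegree_add _ _).trans (max_le (ih k) ihl)
        exact this.trans (Nat.pow_le_pow_right (by norm_num) (by omega))
      | mul l =>
        have : ((l.map C.value).prod).totalDegree ≤ l.length * 2 ^ (m + C.numEdges) := by
          induction l with
          | nil => simp
          | cons k l ihl =>
            rw [List.map_cons, List.prod_cons, List.length_cons]
            refine (MvPolynomial.totalDegree_mul _ _).trans ?_
            have := ih k
            rw [add_mul, one_mul]; omega
        refine this.trans ?_
        calc _ ≤ 2 ^ l.length * 2 ^ (m + C.numEdges) :=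
              Nat.mul_le_mul_right _ Nat.lt_two_pow_self.le
          _ ≤ _ := by
              rw [← pow_add]
              exact Nat.pow_le_pow_right (by norm_num) (by simp only [CircuitGate.fanIn]; omega)
    · rw [← hj]
      exact (ih j).trans (Nat.pow_le_pow_right (by norm_num) (by omega))

theorem totalDegree_le_two_pow_circuitSize (p : MvPolynomial (Fin n) F) :
    p.totalDegree ≤ 2 ^ circuitSize p := by
  obtain ⟨C, rfl, hs⟩ := exists_circuit_size_eq_circuitSize p
  rw [← hs]
  exact C.nodes.totalDegree_value_le C.output

/-! ### Restriction to lines and directional derivatives -/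

/-- Restriction of a polynomial to the line through `β` with direction `α`. -/
noncomputable def lineHom {S : Type*} [CommRing S] [Algebra F S] (α : Fin n → F) (β : Fin n → S) :
    MvPolynomial (Fin n) F →ₐ[F] Polynomial S :=
  MvPolynomial.aeval fun i =>
    Polynomial.C (β i) + Polynomial.C (algebraMap F S (α i)) * Polynomial.X

/-- The derivative in direction `α`. -/
noncomputable def dirDeriv (α : Fin n → F) :
    Derivation F (MvPolynomial (Fin n) F) (MvPolynomial (Fin n) F) :=
  MvPolynomial.mkDerivation F fun i => MvPolynomial.C (α i)

section lineHom

variable {S : Type*} [CommRing S] [Algebra F S] (α : Fin n → F) (β : Fin n → S)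

theorem lineHom_X (i : Fin n) : lineHom α β (MvPolynomial.X i) =
    Polynomial.C (β i) + Polynomial.C (algebraMap F S (α i)) * Polynomial.X := by
  simp [lineHom]

theorem lineHom_C (c : F) : lineHom α β (MvPolynomial.C c) = Polynomial.C (algebraMap F S c) := by
  simp [lineHom, Polynomial.algebraMap_apply]

theorem dirDeriv_C (c : F) : dirDeriv α (MvPolynomial.C c) = 0 :=
  (dirDeriv α).map_algebraMap c

theorem derivative_lineHom (p : MvPolynomial (Fin n) F) :
    Polynomial.derivative (lineHom α β p) = lineHom α β (dirDeriv α p) := by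
  induction p using MvPolynomial.induction_on with
  | C c => rw [dirDeriv_C, lineHom_C]; simp
  | add p q hp hq => simp [hp, hq]
  | mul_X p i hp =>
    rw [map_mul, Polynomial.derivative_mul, hp, Derivation.leibniz, lineHom_X]
    simp only [dirDeriv, MvPolynomial.mkDerivation_X, smul_eq_mul, map_add, map_mul,
      Polynomial.derivative_C, Polynomial.derivative_X, Polynomial.derivative_mul,
      lineHom_C, lineHom_X]
    ring

theorem map_lineHom {T : Type*} [CommRing T] [Algebra F T] (φ : S →ₐ[F] T)
    (p : MvPolynomial (Fin n) F) :
    (lineHom α β p).map (φ : S →+* T) = lineHom α (fun i => φ (β i)) p := by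
  have : (Polynomial.mapAlgHom φ).comp (lineHom α β) = lineHom α (fun i => φ (β i)) := by
    ext1 i
    simp [lineHom_X]
  exact DFunLike.congr_fun this p

theorem natDegree_lineHom_X_le (i : Fin n) : (lineHom α β (MvPolynomial.X i)).natDegree ≤ 1 := by
  rw [lineHom_X]
  compute_degree

theorem lineHom_monomial (m : Fin n →₀ ℕ) (c : F) : lineHom α β (MvPolynomial.monomial m c) =
    Polynomial.C (algebraMap F S c) * ∏ i, lineHom α β (MvPolynomial.X i) ^ m i := by
  rw [MvPolynomial.monomial_eq, map_mul, lineHom_C, Finsupp.prod_fintype _ _ (by simp), map_prod]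
  simp

theorem natDegree_lineHom_monomial_le (m : Fin n →₀ ℕ) (c : F) :
    (lineHom α β (MvPolynomial.monomial m c)).natDegree ≤ m.degree := by
  rw [lineHom_monomial, Finsupp.degree_eq_sum]
  refine (Polynomial.natDegree_C_mul_le _ _).trans ((Polynomial.natDegree_prod_le _ _).trans ?_)
  refine Finset.sum_le_sum fun i _ => ?_
  have := Polynomial.natDegree_pow_le_of_le (m i) (natDegree_lineHom_X_le α β i)
  simpa using this

theorem natDegree_lineHom_le (p : MvPolynomial (Fin n) F) :
    (lineHom α β p).natDegree ≤ p.totalDegree := by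
  conv_lhs => rw [p.as_sum, map_sum]
  refine Polynomial.natDegree_sum_le_of_forall_le _ _ fun m hm => ?_
  exact (natDegree_lineHom_monomial_le α β m _).trans (MvPolynomial.le_totalDegree hm)

theorem coeff_prod_pow_of_natDegree_le_one {ι : Type*} (s : Finset ι) (f : ι → Polynomial S)
    (m : ι → ℕ) (hf : ∀ i ∈ s, (f i).natDegree ≤ 1) :
    (∏ i ∈ s, f i ^ m i).coeff (∑ i ∈ s, m i) = ∏ i ∈ s, (f i).coeff 1 ^ m i := by
  classical
  induction s using Finset.induction_on with
  | empty => simp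
  | insert i s hi ih =>
    rw [Finset.prod_insert hi, Finset.sum_insert hi, Finset.prod_insert hi,
      ← ih fun j hj => hf j (by simp [hj]),
      Polynomial.coeff_mul_add_eq_of_natDegree_le]
    · congr 1
      simpa using Polynomial.coeff_pow_of_natDegree_le (m := m i) (hf i (by simp))
    · simpa using Polynomial.natDegree_pow_le_of_le (m i) (hf i (by simp))
    · refine (Polynomial.natDegree_prod_le _ _).trans (Finset.sum_le_sum fun j hj => ?_)
      simpa using Polynomial.natDegree_pow_le_of_le (m j) (hf j (by simp [hj]))

/-- Only the top form contributes, evaluated at the direction and independent of the base point. A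
single choice of `α` therefore preserves the degree on all parallel lines and makes the leading
coefficient on the generic line a unit. -/
theorem coeff_lineHom (p : MvPolynomial (Fin n) F) {N : ℕ} (hN : p.totalDegree ≤ N) :
    (lineHom α β p).coeff N =
      algebraMap F S (MvPolynomial.eval α (MvPolynomial.homogeneousComponent N p)) := by
  conv_lhs => rw [p.as_sum, map_sum, Polynomial.finsetSum_coeff]
  rw [MvPolynomial.homogeneousComponent_apply, map_sum, map_sum, Finset.sum_filter]
  refine Finset.sum_congr rfl fun m hm => ?_
  have hle : m.degree ≤ N := (MvPolynomial.le_totalDegree hm).trans hN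
  split_ifs with h
  · subst h
    rw [lineHom_monomial, Polynomial.coeff_C_mul, Finsupp.degree_eq_sum,
      coeff_prod_pow_of_natDegree_le_one _ _ _ fun i _ => natDegree_lineHom_X_le α β i,
      MvPolynomial.eval_monomial, Finsupp.prod_fintype _ _ (by simp)]
    simp [lineHom_X]
  · exact Polynomial.coeff_eq_zero_of_natDegree_lt
      ((natDegree_lineHom_monomial_le α β m _).trans_lt (lt_of_le_of_ne hle h))

end lineHom

theorem MvPolynomial.exists_eval_ne_zero [Infinite F] {p : MvPolynomial (Fin n) F} (hp : p ≠ 0) :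
    ∃ z, MvPolynomial.eval z p ≠ 0 := by
  by_contra! h
  exact hp (MvPolynomial.funext fun z => by simp [h z])

theorem MvPolynomial.homogeneousComponent_totalDegree_ne_zero {p : MvPolynomial (Fin n) F}
    (hp : p ≠ 0) : MvPolynomial.homogeneousComponent p.totalDegree p ≠ 0 := by
  obtain ⟨m, hm, hd⟩ := Finset.exists_mem_eq_sup p.support
    (MvPolynomial.support_nonempty.mpr hp) (fun m => m.sum fun _ e => e)
  intro h
  have := congrArg (MvPolynomial.coeff m) h
  rw [MvPolynomial.coeff_homogeneousComponent, if_pos] at this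
  · exact MvPolynomial.mem_support_iff.mp hm (by simpa using this)
  · exact hd.symm

/-! ### Separability on a generic line -/

/-- Restriction of a polynomial to the generic line with direction `α`. -/
noncomputable abbrev genericLine (α : Fin n → F) :
    MvPolynomial (Fin n) F →ₐ[F] Polynomial (MvPolynomial (Fin n) F) :=
  lineHom α MvPolynomial.X

/-- The shear `x ↦ x + y α`, `y ↦ y` of `F[x][y]`. -/
noncomputable def shear (α : Fin n → F) :
    Polynomial (MvPolynomial (Fin n) F) →+* Polynomial (MvPolynomial (Fin n) F) :=
  Polynomial.eval₂RingHom (genericLine α).toRingHom Polynomial.X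

theorem shear_C (α : Fin n → F) (p : MvPolynomial (Fin n) F) :
    shear α (Polynomial.C p) = genericLine α p := by
  simp [shear]

theorem shear_X (α : Fin n → F) :
    shear α Polynomial.X = (Polynomial.X : Polynomial (MvPolynomial (Fin n) F)) := by
  simp [shear]

theorem shear_comp_shear_neg (α : Fin n → F) :
    (shear α).comp (shear (-α)) = RingHom.id (Polynomial (MvPolynomial (Fin n) F)) := by
  refine Polynomial.ringHom_ext' (MvPolynomial.ringHom_ext (fun c => ?_) fun i => ?_) ?_
  · simp only [RingHom.comp_apply, shear_C, lineHom_C, MvPolynomial.algebraMap_eq, RingHom.id_apply]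
  · simp only [RingHom.comp_apply, shear_C, lineHom_X, MvPolynomial.algebraMap_eq, RingHom.id_apply,
      map_add, map_mul, shear_X, lineHom_C, Pi.neg_apply, map_neg, neg_mul,
      add_neg_cancel_right]
  · simp [shear_X]

/-- The shear as an automorphism. -/
noncomputable def shearEquiv (α : Fin n → F) :
    Polynomial (MvPolynomial (Fin n) F) ≃+* Polynomial (MvPolynomial (Fin n) F) :=
  RingEquiv.ofRingHom (shear α) (shear (-α)) (shear_comp_shear_neg α)
    (by simpa using shear_comp_shear_neg (-α))

/-- The shear is an automorphism of `F[x][y]` that carries the constant polynomial `p` to its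
restriction to the generic line. -/
theorem prime_genericLine (α : Fin n → F) {p : MvPolynomial (Fin n) F} (hp : Prime p) :
    Prime (genericLine α p) := by
  have h := (MulEquiv.prime_iff (shearEquiv α)).mpr (Polynomial.prime_C_iff.mpr hp)
  rwa [show (shearEquiv α) (Polynomial.C p) = shear α (Polynomial.C p) from rfl, shear_C] at h

theorem eval_lineHom {S : Type*} [CommRing S] [Algebra F S] (α : Fin n → F) (β : Fin n → S) (y : S)
    (p : MvPolynomial (Fin n) F) : (lineHom α β p).eval y =
      MvPolynomial.aeval (fun i => β i + algebraMap F S (α i) * y) p := by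
  induction p using MvPolynomial.induction_on with
  | C c => simp
  | add p q hp hq => simp [hp, hq]
  | mul_X p i hp => simp [hp, lineHom_X]

theorem eval_zero_lineHom {S : Type*} [CommRing S] [Algebra F S] (α : Fin n → F) (β : Fin n → S)
    (p : MvPolynomial (Fin n) F) : (lineHom α β p).eval 0 = MvPolynomial.aeval β p := by
  simp [eval_lineHom]

theorem dvd_of_genericLine_dvd {α : Fin n → F} {p q : MvPolynomial (Fin n) F}
    (h : genericLine α p ∣ genericLine α q) : p ∣ q := by
  have := map_dvd (Polynomial.evalRingHom (0 : MvPolynomial (Fin n) F)) h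
  simpa [eval_zero_lineHom] using this

theorem isPrimitive_of_dvd_of_isUnit_coeff {S : Type*} [CommRing S] {p q : Polynomial S} {N : ℕ}
    (h : p ∣ q) (hq : IsUnit (q.coeff N)) : p.IsPrimitive := fun r hr =>
  isUnit_of_dvd_unit ((Polynomial.C_dvd_iff_dvd_coeff r q).mp (hr.trans h) N) hq

/-- The unit coefficient makes every factor primitive, so irreducibility and divisibility pass to
the fraction field by Gauss's lemma. Irreducibles are separable in characteristic zero, and distinct
ones stay coprime because setting `y = 0` recovers the original polynomials. -/
theorem separable_map_genericLine [CharZero F] (s : Finset (MvPolynomial (Fin n) F))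
    (hs : ∀ p ∈ s, Irreducible p) (hne : ∀ p ∈ s, ∀ q ∈ s, p ∣ q → p = q) (α : Fin n → F) (N : ℕ)
    (hα : IsUnit ((genericLine α (∏ p ∈ s, p)).coeff N)) :
    ((genericLine α (∏ p ∈ s, p)).map
      (algebraMap (MvPolynomial (Fin n) F) (FractionRing (MvPolynomial (Fin n) F)))).Separable := by
  have : CharZero (FractionRing (MvPolynomial (Fin n) F)) :=
    charZero_of_injective_algebraMap (R := MvPolynomial (Fin n) F)
      (IsFractionRing.injective _ _)
  have hprim : ∀ p ∈ s, (genericLine α p).IsPrimitive := fun p hp =>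
    isPrimitive_of_dvd_of_isUnit_coeff (map_dvd _ (Finset.dvd_prod_of_mem _ hp)) hα
  have hirr : ∀ p ∈ s, Irreducible ((genericLine α p).map
      (algebraMap (MvPolynomial (Fin n) F) (FractionRing (MvPolynomial (Fin n) F)))) :=
    fun p hp => (hprim p hp).irreducible_iff_irreducible_map_fraction_map.mp
      (prime_genericLine α (hs p hp).prime).irreducible
  rw [map_prod, Polynomial.map_prod]
  refine Polynomial.separable_prod' (fun p hp q hq hpq => ?_) fun p hp => (hirr p hp).separable
  refine (hirr p hp).coprime_iff_not_dvd.mpr fun h => hpq (hne p hp q hq ?_)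
  exact dvd_of_genericLine_dvd
    ((hprim p hp).dvd_of_fraction_map_dvd_fraction_map h)

/-- A Bézout identity with cleared denominators; `c` plays the part of a resultant. -/
theorem exists_mul_add_mul_eq_C_of_isCoprime_map {S L : Type*} [CommRing S] [IsDomain S] [Field L]
    [Algebra S L] [IsFractionRing S L] {p q : Polynomial S}
    (h : IsCoprime (p.map (algebraMap S L)) (q.map (algebraMap S L))) :
    ∃ (u v : Polynomial S) (c : S), c ≠ 0 ∧ u * p + v * q = Polynomial.C c := by
  obtain ⟨a, b, hab⟩ := h
  obtain ⟨c, hc, hca⟩ := IsLocalization.integerNormalization_spec (nonZeroDivisors S) a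
  obtain ⟨e, he, heb⟩ := IsLocalization.integerNormalization_spec (nonZeroDivisors S) b
  rw [← algebraMap_smul L, Polynomial.smul_eq_C_mul] at hca heb
  refine ⟨Polynomial.C e * IsLocalization.integerNormalization (nonZeroDivisors S) a,
    Polynomial.C c * IsLocalization.integerNormalization (nonZeroDivisors S) b, c * e,
    mul_ne_zero (nonZeroDivisors.ne_zero hc) (nonZeroDivisors.ne_zero he), ?_⟩
  apply Polynomial.map_injective _ (IsFractionRing.injective S L)
  simp only [Polynomial.map_add, Polynomial.map_mul, hca, heb, Polynomial.map_C,
    map_mul]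
  linear_combination Polynomial.C (algebraMap S L c) * Polynomial.C (algebraMap S L e) * hab

/-- Here `δ` serves as a discriminant of the generic restriction: the Bézout identity between it and
its derivative survives the specialization `x ↦ β` as soon as `δ` does not vanish at `β`. -/
theorem exists_ne_zero_forall_separable_lineHom [CharZero F] (s : Finset (MvPolynomial (Fin n) F))
    (hs : ∀ p ∈ s, Irreducible p) (hne : ∀ p ∈ s, ∀ q ∈ s, p ∣ q → p = q) (α : Fin n → F) (N : ℕ)
    (hα : IsUnit ((genericLine α (∏ p ∈ s, p)).coeff N)) :
    ∃ δ : MvPolynomial (Fin n) F, δ ≠ 0 ∧ ∀ β : Fin n → F, MvPolynomial.eval β δ ≠ 0 →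
      (lineHom α β (∏ p ∈ s, p)).Separable := by
  have h := separable_map_genericLine s hs hne α N hα
  rw [Polynomial.Separable, Polynomial.derivative_map] at h
  obtain ⟨u, v, δ, hδ, huv⟩ := exists_mul_add_mul_eq_C_of_isCoprime_map h
  refine ⟨δ, hδ, fun β hβ => ?_⟩
  have hline : ∀ p, (genericLine α p).map (MvPolynomial.eval β) = lineHom α β p := fun p => by
    have := map_lineHom α (MvPolynomial.X : Fin n → MvPolynomial (Fin n) F)
      (MvPolynomial.aeval β : _ →ₐ[F] F) p
    simp only [MvPolynomial.aeval_X] at this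
    rw [← this]
    congr 1
  have := congrArg (Polynomial.map (MvPolynomial.eval β)) huv
  rw [Polynomial.map_add, Polynomial.map_mul, Polynomial.map_mul, ← Polynomial.derivative_map,
    hline, Polynomial.map_C] at this
  obtain ⟨w, hw⟩ := (Polynomial.isUnit_C.mpr (isUnit_iff_ne_zero.mpr hβ)).exists_left_inv
  refine ⟨w * u.map (MvPolynomial.eval β), w * v.map (MvPolynomial.eval β), ?_⟩
  rw [mul_assoc, mul_assoc, ← mul_add, this, hw]

/-! ### The logarithmic derivative and the radical -/

/-- The logarithmic derivative of `∏ p ^ e p` has denominator `∏ p`; its numerator `A` has no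
common zeros with the denominator, except at zeros of the derivative of the latter. -/
theorem exists_logDeriv_numerator [CharZero F]
    (D : Derivation F (MvPolynomial (Fin n) F) (MvPolynomial (Fin n) F))
    (s : Finset (MvPolynomial (Fin n) F)) (e : MvPolynomial (Fin n) F → ℕ)
    (he : ∀ p ∈ s, e p ≠ 0) :
    ∃ A : MvPolynomial (Fin n) F, (∏ p ∈ s, p) * D (∏ p ∈ s, p ^ e p) = (∏ p ∈ s, p ^ e p) * A ∧
      ∀ z, MvPolynomial.eval z (∏ p ∈ s, p) = 0 → MvPolynomial.eval z A = 0 →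
        MvPolynomial.eval z (D (∏ p ∈ s, p)) = 0 := by
  classical
  induction s using Finset.induction_on with
  | empty => exact ⟨0, by simp, by simp⟩
  | insert p s hp ih =>
    obtain ⟨A, hA, hz⟩ := ih fun q hq => he q (by simp [hq])
    have hep := he p (by simp)
    -- The new logarithmic derivative is `e p * D p / p + A / ∏ q`, brought to a common denominator.
    refine ⟨p * A + (e p : MvPolynomial (Fin n) F) * (∏ q ∈ s, q) * D p, ?_, fun z h1 h2 => ?_⟩
    · rw [Finset.prod_insert hp, Finset.prod_insert hp, Derivation.leibniz, Derivation.leibniz_pow]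
      simp only [smul_eq_mul, nsmul_eq_mul]
      obtain ⟨k, hk⟩ := Nat.exists_eq_succ_of_ne_zero hep
      rw [hk, Nat.succ_sub_one, pow_succ]
      linear_combination p ^ k * p * p * hA
    · rw [Finset.prod_insert hp, map_mul] at h1
      rw [Finset.prod_insert hp, Derivation.leibniz]
      simp only [smul_eq_mul, map_add, map_mul, map_natCast] at h2 ⊢
      -- At a zero of `p` only the term with `D p` survives, and characteristic zero allows
      -- cancelling `e p`. Otherwise `∏ q` and `A` vanish at `z` and the induction hypothesis
      -- applies.
      rcases eq_or_ne (MvPolynomial.eval z p) 0 with h | h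
      · rw [h, zero_mul, zero_add, mul_assoc, mul_eq_zero] at h2
        rw [h, zero_mul, zero_add]
        exact h2.resolve_left (by exact_mod_cast hep)
      · have h3 := (mul_eq_zero.mp h1).resolve_left h
        rw [h3, mul_zero, zero_mul, add_zero] at h2
        rw [h3, zero_mul, add_zero, hz z h3 ((mul_eq_zero.mp h2).resolve_left h), mul_zero]

theorem totalDegree_dirDeriv_le (α : Fin n → F) (p : MvPolynomial (Fin n) F) {N : ℕ}
    (hp : p.totalDegree ≤ N + 1) : (dirDeriv α p).totalDegree ≤ N := by
  rw [p.as_sum, map_sum]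
  refine MvPolynomial.totalDegree_finsetSum_le fun m hm => ?_
  have hmN : m.degree ≤ N + 1 := (MvPolynomial.le_totalDegree hm).trans hp
  rw [dirDeriv, MvPolynomial.mkDerivation_monomial]
  refine (MvPolynomial.totalDegree_smul_le _ _).trans
    (MvPolynomial.totalDegree_finsetSum_le fun i hi => ?_)
  change MvPolynomial.totalDegree (_ * _) ≤ N
  refine (MvPolynomial.totalDegree_mul _ _).trans ?_
  rw [MvPolynomial.totalDegree_C, add_zero]
  refine (MvPolynomial.totalDegree_monomial_le _ _).trans ?_
  have h1 : Finsupp.single i 1 ≤ m := by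
    rw [Finsupp.single_le_iff]
    exact Nat.one_le_iff_ne_zero.mpr (Finsupp.mem_support_iff.mp hi)
  have h2 : (m - Finsupp.single i 1).degree + 1 = m.degree := by
    conv_rhs => rw [← tsub_add_cancel_of_le h1]
    simp
  change (m - Finsupp.single i 1).degree ≤ N
  omega

/-- A derivation with constant coefficients lowers degrees, and degrees add in a domain: compare
both sides of `h`. -/
theorem totalDegree_logDeriv_numerator_lt (α : Fin n → F) {R u A : MvPolynomial (Fin n) F}
    (hu : u ≠ 0) (hR : 0 < R.totalDegree) (h : R * dirDeriv α u = u * A) :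
    A.totalDegree < R.totalDegree := by
  rcases eq_or_ne A 0 with rfl | hA
  · simpa
  have hD : dirDeriv α u ≠ 0 := by
    intro h0
    rw [h0, mul_zero] at h
    exact mul_ne_zero hu hA h.symm
  have hR0 : R ≠ 0 := by rintro rfl; simp at hR
  have hdeg := congrArg MvPolynomial.totalDegree h
  rw [MvPolynomial.totalDegree_mul_of_isDomain hR0 hD,
    MvPolynomial.totalDegree_mul_of_isDomain hu hA] at hdeg
  have hu0 : u.totalDegree ≠ 0 := by
    intro h0
    rw [MvPolynomial.totalDegree_eq_zero_iff_eq_C.mp h0] at hD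
    exact hD (dirDeriv_C _ _)
  have := totalDegree_dirDeriv_le α u (N := u.totalDegree - 1) (by omega)
  omega

open UniqueFactorizationMonoid in
-- One set of representatives, the normalized prime factors of `u`, serves all divisors of `u`;
-- primes absent from `g` get exponent zero. Normalization turns associates into equals.
theorem exists_polyRad_factorization (u : MvPolynomial (Fin n) F) (hu : u ≠ 0) :
    ∃ s : Finset (MvPolynomial (Fin n) F), polyRad u = ∏ p ∈ s, p ∧ (∀ p ∈ s, Irreducible p) ∧
      (∀ p ∈ s, ∀ q ∈ s, p ∣ q → p = q) ∧ (∀ p ∈ s, p ∣ u) ∧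
      ∀ g, g ∣ u → ∃ (e : MvPolynomial (Fin n) F → ℕ) (c : F), c ≠ 0 ∧
        (∀ p ∈ s, p ∣ g → e p ≠ 0) ∧ g = MvPolynomial.C c * ∏ p ∈ s, p ^ e p := by
  classical
  -- This must be the instance used in `polyRad`, so that the first claim holds by `rfl`.
  let _ : StrongNormalizationMonoid (MvPolynomial (Fin n) F) :=
    UniqueFactorizationMonoid.strongNormalizationMonoid
  refine ⟨primeFactors u, rfl, fun p hp => ?_, fun p hp q hq hpq => ?_, fun p hp => ?_,
    fun g hg => ?_⟩
  · exact irreducible_of_normalized_factor p (mem_primeFactors.mp hp)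
  · have h1 := mem_primeFactors.mp hp
    have h2 := mem_primeFactors.mp hq
    have h3 := (irreducible_of_normalized_factor p h1).associated_of_dvd
      (irreducible_of_normalized_factor q h2) hpq
    have := normalize_eq_normalize_iff_associated.mpr h3
    rwa [normalize_normalized_factor p h1, normalize_normalized_factor q h2] at this
  · exact dvd_of_mem_normalizedFactors (mem_primeFactors.mp hp)
  · have hg0 : g ≠ 0 := ne_zero_of_dvd_ne_zero hu hg
    obtain ⟨w, hw⟩ := (prod_normalizedFactors hg0)
    obtain ⟨c, hc, hcw⟩ := MvPolynomial.isUnit_iff_eq_C_of_isReduced.mp w.isUnit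
    refine ⟨fun p => (normalizedFactors g).count p, c, hc.ne_zero, fun p hp hpg => ?_, ?_⟩
    · have h1 := mem_primeFactors.mp hp
      obtain ⟨q, hq, hpq⟩ := exists_mem_normalizedFactors_of_dvd hg0
        (irreducible_of_normalized_factor p h1) hpg
      have := normalize_eq_normalize_iff_associated.mpr hpq
      rw [normalize_normalized_factor p h1, normalize_normalized_factor q hq] at this
      rw [this]
      exact Multiset.count_ne_zero.mpr hq
    rw [← hcw]
    refine hw.symm.trans ((mul_comm _ _).trans ?_)
    congr 1
    rw [Finset.prod_multiset_count (normalizedFactors g)]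
    refine Finset.prod_subset (fun p hp => ?_) fun p _ hp => ?_
    · rw [mem_primeFactors]
      exact Multiset.mem_of_le
        ((dvd_iff_normalizedFactors_le_normalizedFactors hg0 hu).mp hg) (Multiset.mem_toFinset.mp hp)
    · rw [Multiset.count_eq_zero_of_notMem fun h => hp (Multiset.mem_toFinset.mpr h), pow_zero]

/-! ### Expansion in the homotopy parameter -/

/-- A bound for the total degree of a bivariate polynomial. -/
def BidegreeLE {S : Type*} [CommRing S] (N : ℕ) (Q : Polynomial (Polynomial S)) : Prop :=
  ∀ k j, (Q.coeff k).coeff j ≠ 0 → k + j ≤ N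

namespace BidegreeLE

variable {S : Type*} [CommRing S] {N M : ℕ} {P Q : Polynomial (Polynomial S)}

theorem mono (h : BidegreeLE N P) (hN : N ≤ M) : BidegreeLE M P :=
  fun k j hkj => (h k j hkj).trans hN

theorem C_C (a : S) : BidegreeLE 0 (Polynomial.C (Polynomial.C a)) := by
  intro k j h
  rw [Polynomial.coeff_C] at h
  split_ifs at h with hk
  · rw [Polynomial.coeff_C] at h
    split_ifs at h with hj
    · omega
    · exact absurd rfl h
  · simp at h

theorem X : BidegreeLE 1 (Polynomial.X : Polynomial (Polynomial S)) := by
  intro k j h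
  rw [Polynomial.coeff_X] at h
  split_ifs at h with hk
  · rw [Polynomial.coeff_one] at h
    split_ifs at h with hj
    · omega
    · exact absurd rfl h
  · simp at h

theorem C_X : BidegreeLE 1 (Polynomial.C Polynomial.X : Polynomial (Polynomial S)) := by
  intro k j h
  rw [Polynomial.coeff_C] at h
  split_ifs at h with hk
  · rw [Polynomial.coeff_X] at h
    split_ifs at h with hj
    · omega
    · exact absurd rfl h
  · simp at h

theorem add (hP : BidegreeLE N P) (hQ : BidegreeLE N Q) : BidegreeLE N (P + Q) := by
  intro k j h
  rw [Polynomial.coeff_add, Polynomial.coeff_add] at h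
  by_contra hlt
  rw [not_imp_comm.mp (hP k j) hlt, not_imp_comm.mp (hQ k j) hlt, add_zero] at h
  exact h rfl

theorem mul (hP : BidegreeLE N P) (hQ : BidegreeLE M Q) : BidegreeLE (N + M) (P * Q) := by
  intro k j h
  rw [Polynomial.coeff_mul, Polynomial.finsetSum_coeff] at h
  obtain ⟨⟨a, b⟩, hab, h⟩ := Finset.exists_ne_zero_of_sum_ne_zero h
  rw [Polynomial.coeff_mul] at h
  obtain ⟨⟨c, d⟩, hcd, h⟩ := Finset.exists_ne_zero_of_sum_ne_zero h
  have h1 := hP a c (left_ne_zero_of_mul h)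
  have h2 := hQ b d (right_ne_zero_of_mul h)
  rw [Finset.HasAntidiagonal.mem_antidiagonal] at hab hcd
  dsimp only at h1 h2 hab hcd
  omega

theorem pow (hP : BidegreeLE N P) (m : ℕ) : BidegreeLE (m * N) (P ^ m) := by
  induction m with
  | zero => simpa using C_C (1 : S)
  | succ m ih => rw [pow_succ, add_mul, one_mul]; exact ih.mul hP

theorem prod {ι : Type*} (s : Finset ι) (P : ι → Polynomial (Polynomial S)) (N : ι → ℕ)
    (h : ∀ i ∈ s, BidegreeLE (N i) (P i)) : BidegreeLE (∑ i ∈ s, N i) (∏ i ∈ s, P i) := by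
  classical
  induction s using Finset.induction_on with
  | empty => simpa using C_C (1 : S)
  | insert i s hi ih =>
    rw [Finset.prod_insert hi, Finset.sum_insert hi]
    exact (h i (by simp)).mul (ih fun j hj => h j (by simp [hj]))

theorem sum {ι : Type*} (s : Finset ι) (P : ι → Polynomial (Polynomial S))
    (h : ∀ i ∈ s, BidegreeLE N (P i)) : BidegreeLE N (∑ i ∈ s, P i) := by
  classical
  induction s using Finset.induction_on with
  | empty => intro k j h; simp at h
  | insert i s hi ih =>
    rw [Finset.sum_insert hi]
    exact (h i (by simp)).add (ih fun j hj => h j (by simp [hj]))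

end BidegreeLE

/-- The substitution `x ↦ β + y α + t (x - β)`, as a polynomial in `t` over `F[x][y]`. -/
noncomputable def homotopyHom (α β : Fin n → F) :
    MvPolynomial (Fin n) F →ₐ[F] Polynomial (Polynomial (MvPolynomial (Fin n) F)) :=
  MvPolynomial.aeval fun i =>
    Polynomial.C (Polynomial.C (MvPolynomial.C (β i))) +
      Polynomial.C (Polynomial.C (MvPolynomial.C (α i))) * Polynomial.C Polynomial.X +
      Polynomial.C (Polynomial.C (MvPolynomial.X i - MvPolynomial.C (β i))) * Polynomial.X

section homotopyHom

variable (α β : Fin n → F)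

theorem homotopyHom_X (i : Fin n) : homotopyHom α β (MvPolynomial.X i) =
    Polynomial.C (Polynomial.C (MvPolynomial.C (β i))) +
      Polynomial.C (Polynomial.C (MvPolynomial.C (α i))) * Polynomial.C Polynomial.X +
      Polynomial.C (Polynomial.C (MvPolynomial.X i - MvPolynomial.C (β i))) * Polynomial.X := by
  rw [homotopyHom, MvPolynomial.aeval_X]

theorem homotopyHom_C (c : F) : homotopyHom α β (MvPolynomial.C c) =
    Polynomial.C (Polynomial.C (MvPolynomial.C c)) := by
  rw [homotopyHom, MvPolynomial.aeval_C]
  rfl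

/-- Each variable becomes a polynomial of degree at most one in `t` and `y` jointly. Hence the order
`k` part in `t` has degree at most `deg p - k` in `y`, which bounds the number of unknowns at each
order. -/
theorem bidegreeLE_homotopyHom (p : MvPolynomial (Fin n) F) :
    BidegreeLE p.totalDegree (homotopyHom α β p) := by
  rw [congrArg (homotopyHom α β) p.as_sum, map_sum]
  refine BidegreeLE.sum _ _ fun m hm => BidegreeLE.mono ?_ (MvPolynomial.le_totalDegree hm)
  rw [MvPolynomial.monomial_eq, map_mul, homotopyHom_C, Finsupp.prod_fintype _ _ (by simp),
    map_prod]
  have h := BidegreeLE.prod (Finset.univ : Finset (Fin n))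
    (fun i => homotopyHom α β (MvPolynomial.X i ^ m i)) (fun i => m i) fun i _ => ?_
  · have := (BidegreeLE.C_C (MvPolynomial.C (σ := Fin n) (p.coeff m))).mul h
    rw [zero_add, ← Finsupp.degree_eq_sum] at this
    exact this
  · rw [map_pow, homotopyHom_X]
    have h1 := (((BidegreeLE.C_C (MvPolynomial.C (σ := Fin n) (β i))).mono zero_le_one).add
      ((BidegreeLE.C_C (MvPolynomial.C (σ := Fin n) (α i))).mul BidegreeLE.C_X)).add
      ((BidegreeLE.C_C (MvPolynomial.X i - MvPolynomial.C (β i))).mul BidegreeLE.X)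
    simpa using h1.pow (m i)

/-- At `t = 0` the variables disappear, so the starting data of the lifting lie over `F` and enter
the circuit as constants, however hard they may be to find. -/
theorem coeff_zero_homotopyHom (p : MvPolynomial (Fin n) F) :
    (homotopyHom α β p).coeff 0 = (lineHom α β p).map MvPolynomial.C := by
  induction p using MvPolynomial.induction_on with
  | C c => simp
  | add p q hp hq => simp [hp, hq]
  | mul_X p i hp =>
    simp [Polynomial.mul_coeff_zero, hp, homotopyHom_X, lineHom_X]

theorem eval_homotopyHom (p : MvPolynomial (Fin n) F) :
    ((homotopyHom α β p).eval 1).eval 0 = p := by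
  induction p using MvPolynomial.induction_on with
  | C c => simp
  | add p q hp hq => simp [hp, hq]
  | mul_X p i hp => simp [hp, homotopyHom_X]

/-- At `t = 1`, `y = 0` the substitution is the identity. -/
theorem sum_coeff_homotopyHom (p : MvPolynomial (Fin n) F) {N : ℕ} (hN : p.totalDegree ≤ N) :
    ∑ k ∈ Finset.range (N + 1), ((homotopyHom α β p).coeff k).coeff 0 = p := by
  have hdeg : (homotopyHom α β p).natDegree < N + 1 := by
    rw [Nat.lt_succ_iff, Polynomial.natDegree_le_iff_coeff_eq_zero]
    intro k hk
    ext1 j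
    by_contra h
    have := bidegreeLE_homotopyHom α β p k j h
    omega
  conv_rhs => rw [← eval_homotopyHom α β p, Polynomial.eval_eq_sum_range' hdeg]
  simp [Polynomial.eval_finsetSum, Polynomial.coeff_zero_eq_eval_zero]

/-- The expansion along the segment from `β + c α` to `x`. -/
noncomputable def segmentHom (c : F) :
    MvPolynomial (Fin n) F →+* Polynomial (MvPolynomial (Fin n) F) :=
  (Polynomial.mapRingHom (Polynomial.evalRingHom (MvPolynomial.C c))).comp
    (homotopyHom α β).toRingHom

theorem coeff_segmentHom (c : F) (p : MvPolynomial (Fin n) F) (k : ℕ) :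
    (segmentHom α β c p).coeff k =
      ((homotopyHom α β p).coeff k).eval (MvPolynomial.C c) := by
  simp [segmentHom]

theorem coeff_zero_segmentHom (c : F) (p : MvPolynomial (Fin n) F) :
    (segmentHom α β c p).coeff 0 = MvPolynomial.C ((lineHom α β p).eval c) := by
  rw [coeff_segmentHom, coeff_zero_homotopyHom, Polynomial.eval_map, Polynomial.eval₂_at_apply]

theorem segmentHom_X (c : F) (i : Fin n) : segmentHom α β c (MvPolynomial.X i) =
    Polynomial.C (MvPolynomial.C (β i + α i * c)) +
      Polynomial.C (MvPolynomial.X i - MvPolynomial.C (β i)) * Polynomial.X := by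
  simp [segmentHom, homotopyHom_X]

theorem segmentHom_C (c a : F) : segmentHom α β c (MvPolynomial.C a) =
    Polynomial.C (MvPolynomial.C a) := by
  simp [segmentHom]

end homotopyHom

/-! ### Truncated power series arithmetic -/

namespace RelCost

variable {S T : Set (MvPolynomial (Fin n) F)}

theorem coeff_mul {P Q : Polynomial (MvPolynomial (Fin n) F)} {k d : ℕ} (hk : k ≤ d)
    (hP : ∀ j ≤ k, P.coeff j ∈ S) (hQ : ∀ j ≤ k, Q.coeff j ∈ S) :
    RelCost S {(P * Q).coeff k} (4 * (d + 1) + 1) := by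
  rw [Polynomial.coeff_mul]
  refine (sum_mul _ (fun x : ℕ × ℕ => P.coeff x.1) (fun x => Q.coeff x.2) (fun x hx => hP _ ?_)
    fun x hx => hQ _ ?_).le ?_
  · rw [Finset.HasAntidiagonal.mem_antidiagonal] at hx; omega
  · rw [Finset.HasAntidiagonal.mem_antidiagonal] at hx; omega
  · rw [Finset.Nat.card_antidiagonal]; omega

/-- Coefficients of order at most `d` of a sum or product depend only on those of the operands, so
the truncated series are propagated gate by gate. The degrees of the polynomials in `T` play no
role, which keeps the degree of `f` out of the final bound. -/
theorem coeffs_segmentHom (α β : Fin n → F) (c : F) (d : ℕ) {t : ℕ} (h : RelCost ∅ T t) :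
    RelCost ∅ (⋃ p ∈ T, (segmentHom α β c p).coeff '' (Finset.range (d + 1)))
      ((d + 1) * (4 * (d + 1) + 11) * t) := by
  have hmem : ∀ (p : MvPolynomial (Fin n) F) (k : ℕ), k ≤ d → (segmentHom α β c p).coeff k ∈
      (segmentHom α β c p).coeff '' (Finset.range (d + 1)) := fun p k hk =>
    ⟨k, by simpa using Nat.lt_succ_of_le hk, rfl⟩
  refine simulate_set (Φ := fun p => (segmentHom α β c p).coeff '' (Finset.range (d + 1)))
    (fun i => ?_) (fun a => ?_) (fun p q => ?_) (fun p q => ?_) h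
  · refine (image (a := 13) _ _ fun k _ => ?_).le ?_
    · rw [segmentHom_X]
      match k with
      | 0 => simpa using (const (S := ∅) (n := n) (β i + α i * c)).le (by norm_num)
      | 1 =>
        have := ((var (S := ∅) (F := F) i).union (const (β i))).comp
          (sub (p := MvPolynomial.X i) (q := MvPolynomial.C (β i)) (by simp) (by simp))
        simpa [Polynomial.coeff_C] using this
      | k + 2 =>
        have := (const (S := ∅) (n := n) (0 : F)).le (b := 13) (by norm_num)
        simpa [Polynomial.coeff_C, Polynomial.coeff_X] using this
    · rw [Finset.card_range]
      exact Nat.mul_le_mul_left _ (by omega)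
  · refine (image (a := 1) _ _ fun k _ => ?_).le ?_
    · rw [segmentHom_C, Polynomial.coeff_C]
      split_ifs
      · exact const a
      · rw [← MvPolynomial.C_0]; exact const 0
    · rw [Finset.card_range]
      exact Nat.mul_le_mul_left _ (by omega)
  · refine (image (a := 3) _ _ fun k hk => ?_).le ?_
    · rw [map_add, Polynomial.coeff_add]
      have hk' : k ≤ d := by simpa [Nat.lt_succ_iff] using hk
      exact add (Or.inl (hmem p k hk')) (Or.inr (hmem q k hk'))
    · rw [Finset.card_range]
      exact Nat.mul_le_mul_left _ (by omega)
  · refine (image (a := 4 * (d + 1) + 1) _ _ fun k hk => ?_).le ?_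
    · rw [map_mul]
      have hk' : k ≤ d := by simpa [Nat.lt_succ_iff] using hk
      exact coeff_mul hk' (fun j hj => Or.inl (hmem p j (hj.trans hk')))
        fun j hj => Or.inr (hmem q j (hj.trans hk'))
    · rw [Finset.card_range]
      exact Nat.mul_le_mul_left _ (by omega)

end RelCost

/-! ### The linear system of the lifting step -/

/-- Multiplying `h` by `p₀ q₀` and using `hrel`, one may cancel `M₀` and gets `(x q₀ + w p₀) A₀ = v
p₀ q₀` at the `m` points. Both sides have degree below `2 deg (p₀ q₀) ≤ m`, so this is an identity.
As `p₀ q₀` is coprime to `A₀`, it divides `x q₀ + w p₀`, which has smaller degree and thus vanishes;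
then `p₀` divides `x`, and all three unknowns are zero. -/
theorem Polynomial.eq_zero_of_eval_mul_eq {p₀ q₀ A₀ N₀ M₀ x w v : Polynomial F} {m : ℕ}
    (hrel : p₀ * q₀ * N₀ = A₀ * M₀) (hpq : IsCoprime p₀ q₀) (hRA : IsCoprime (p₀ * q₀) A₀)
    (h0 : p₀ * q₀ ≠ 0) (hA : A₀.degree < (p₀ * q₀).degree) (hx : x.degree < p₀.degree)
    (hw : w.degree < q₀.degree) (hv : v.degree < (p₀ * q₀).degree) (c : Fin m → F)
    (hc : Function.Injective c) (hm : 2 * (p₀ * q₀).natDegree ≤ m)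
    (hM : ∀ l, M₀.eval (c l) ≠ 0)
    (h : ∀ l, x.eval (c l) * (q₀.eval (c l) * N₀.eval (c l)) +
      w.eval (c l) * (p₀.eval (c l) * N₀.eval (c l)) = v.eval (c l) * M₀.eval (c l)) :
    x = 0 ∧ w = 0 ∧ v = 0 := by
  have hp0 := left_ne_zero_of_mul h0
  have hq0 := right_ne_zero_of_mul h0
  have hr : (x * q₀ + w * p₀).degree < (p₀ * q₀).degree := by
    refine (degree_add_le _ _).trans_lt (max_lt ?_ ?_)
    · rw [degree_mul, degree_mul]
      exact WithBot.add_lt_add_right (by simpa using hq0) hx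
    · rw [degree_mul, degree_mul, add_comm]
      exact WithBot.add_lt_add_left (by simpa using hp0) hw
  have hzero : (x * q₀ + w * p₀) * A₀ - v * (p₀ * q₀) = 0 := by
    refine eq_zero_of_degree_lt_of_eval_index_eq_zero (s := Finset.univ) (v := c)
      (fun _ _ _ _ h => hc h) ?_ fun l _ => ?_
    · rw [Finset.card_univ, Fintype.card_fin]
      have hd : (p₀ * q₀).degree + (p₀ * q₀).degree ≤ (m : WithBot ℕ) := by
        rw [degree_eq_natDegree h0]
        exact_mod_cast (by omega)
      refine lt_of_lt_of_le ?_ hd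
      refine (degree_sub_le _ _).trans_lt (max_lt ?_ ?_)
      · rw [degree_mul]
        exact (add_le_add_right hA.le _).trans_lt
          (WithBot.add_lt_add_right (by simpa using h0) hr)
      · rw [degree_mul (p := v)]
        exact WithBot.add_lt_add_right (by simpa using h0) hv
    · have h1 := congrArg (eval (c l)) hrel
      have h2 := h l
      simp only [eval_mul, eval_add, eval_sub] at h1 h2 ⊢
      refine mul_right_cancel₀ (hM l) ?_
      linear_combination (p₀.eval (c l) * q₀.eval (c l)) * h2 -
        (x.eval (c l) * q₀.eval (c l) + w.eval (c l) * p₀.eval (c l)) * h1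
  have hr0 : x * q₀ + w * p₀ = 0 := by
    refine eq_zero_of_dvd_of_degree_lt (hRA.dvd_of_dvd_mul_right ?_) hr
    exact ⟨v, by linear_combination hzero⟩
  have hx0 : x = 0 := by
    refine eq_zero_of_dvd_of_degree_lt (hpq.dvd_of_dvd_mul_right ?_) hx
    exact ⟨-w, by linear_combination hr0⟩
  subst hx0
  refine ⟨rfl, ?_, ?_⟩
  · simpa [hp0] using hr0
  · rw [hr0] at hzero
    simpa [h0] using hzero

theorem Matrix.exists_mul_eq_one_of_mulVec_eq_zero {ι κ : Type*} [Fintype ι] [Fintype κ]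
    [DecidableEq ι] (T : Matrix κ ι F) (h : ∀ v, T.mulVec v = 0 → v = 0) :
    ∃ S : Matrix ι κ F, S * T = 1 := by
  classical
  obtain ⟨g, hg⟩ := LinearMap.exists_leftInverse_of_injective (Matrix.toLin' T)
    (LinearMap.ker_eq_bot'.mpr fun v hv => h v (by simpa using hv))
  refine ⟨LinearMap.toMatrix' g, ?_⟩
  rw [← LinearMap.toMatrix'_toLin' T, ← LinearMap.toMatrix'_comp, hg, LinearMap.toMatrix'_id]

/-- The unknowns live in a larger ring, but the system has coefficients in `F`: its solution is a
combination of the right-hand sides with fixed scalars, without any division in `S`. -/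
theorem Matrix.eq_sum_of_mul_eq_one {ι κ S : Type*} [Fintype ι] [Fintype κ] [DecidableEq ι]
    [CommRing S] (φ : F →+* S) {L : Matrix ι κ F} {T : Matrix κ ι F} (h : L * T = 1) {v : ι → S}
    {r : κ → S} (hv : ∀ l, ∑ i, φ (T l i) * v i = r l) (i : ι) :
    v i = ∑ l, φ (L i l) * r l := by
  have h1 : (L.map φ).mulVec ((T.map φ).mulVec v) = v := by
    rw [Matrix.mulVec_mulVec, ← Matrix.map_mul, h, Matrix.map_one φ φ.map_zero φ.map_one,
      Matrix.one_mulVec]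
  have h2 : (T.map φ).mulVec v = r := funext fun l => hv l
  rw [h2] at h1
  exact (congrFun h1 i).symm

/-- For `k ≠ 0` the order `k` parts of `P` and `Q` multiply to order `2 k > k`, so they enter the
order `k` part of the product only linearly. -/
theorem Polynomial.coeff_mul_mul_eq_add {S : Type*} [CommRing S] (P Q N : Polynomial S) {k : ℕ}
    (hk : k ≠ 0) : (P * Q * N).coeff k = (P.erase k * Q.erase k * N).coeff k +
      (P.coeff k * (Q.coeff 0 * N.coeff 0) + Q.coeff k * (P.coeff 0 * N.coeff 0)) := by
  have hP := P.monomial_add_erase k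
  have hQ := Q.monomial_add_erase k
  have hcoeff : ∀ (a : S) (G : Polynomial S), (monomial k a * G).coeff k = a * G.coeff 0 := by
    intro a G
    simpa using coeff_monomial_mul G k 0 a
  have : P * Q * N = P.erase k * Q.erase k * N + (monomial k (P.coeff k) * (Q * N) +
      monomial k (Q.coeff k) * (P.erase k * N)) := by
    linear_combination (-(Q * N)) * hP - (P.erase k * N) * hQ
  rw [this, coeff_add, coeff_add, hcoeff, hcoeff, mul_coeff_zero, mul_coeff_zero,
    coeff_erase, if_neg hk.symm]

theorem Polynomial.coeff_mul_eq_add {S : Type*} [CommRing S] (A M : Polynomial S) (k : ℕ) :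
    (A * M).coeff k = (A.erase k * M).coeff k + A.coeff k * M.coeff 0 := by
  have hA := A.monomial_add_erase k
  have hcoeff : (monomial k (A.coeff k) * M).coeff k = A.coeff k * M.coeff 0 := by
    simpa using coeff_monomial_mul M k 0 (A.coeff k)
  rw [← hcoeff, ← coeff_add, ← add_mul, add_comm, hA]

/-- The order `k` part of `A M - P Q N` along the `l`-th segment that does not involve the order `k`
parts of `A`, `P` and `Q`. -/
noncomputable def liftResidual (α β : Fin n → F) (P Q A N M : MvPolynomial (Fin n) F) (c : F)
    (k : ℕ) : MvPolynomial (Fin n) F :=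
  ((segmentHom α β c A).erase k * segmentHom α β c M).coeff k -
    ((segmentHom α β c P).erase k * (segmentHom α β c Q).erase k * segmentHom α β c N).coeff k

theorem Polynomial.eval_eq_sum_fin {S : Type*} [CommRing S] {P : Polynomial S} {a : ℕ}
    (h : ∀ i, a ≤ i → P.coeff i = 0) (y : S) : P.eval y = ∑ i : Fin a, y ^ (i : ℕ) * P.coeff i := by
  rcases Nat.eq_zero_or_pos a with rfl | ha
  · obtain rfl : P = 0 := Polynomial.ext fun i => by simpa using h i (Nat.zero_le i)
    simp
  · have hdeg : P.natDegree < a := by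
      by_contra hlt
      have h0 := h P.natDegree (not_lt.mp hlt)
      rw [Polynomial.coeff_natDegree, Polynomial.leadingCoeff_eq_zero] at h0
      rw [h0, Polynomial.natDegree_zero] at hlt
      exact hlt ha
    rw [Polynomial.eval_eq_sum_range' hdeg,
      Fin.sum_univ_eq_sum_range (fun i => y ^ i * P.coeff i) a]
    exact Finset.sum_congr rfl fun i _ => mul_comm _ _

theorem natDegree_coeff_homotopyHom (α β : Fin n → F) (P : MvPolynomial (Fin n) F) {k i : ℕ}
    (h : P.totalDegree < k + i) : ((homotopyHom α β P).coeff k).coeff i = 0 := by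
  by_contra h0
  have := bidegreeLE_homotopyHom α β P k i h0
  omega

theorem segmentHom_relation (α β : Fin n → F) {P Q A N M : MvPolynomial (Fin n) F}
    (h : P * Q * N = A * M) (c : F) {k : ℕ} (hk : k ≠ 0) :
    (segmentHom α β c P).coeff k *
        MvPolynomial.C ((lineHom α β Q).eval c * (lineHom α β N).eval c) +
      (segmentHom α β c Q).coeff k *
        MvPolynomial.C ((lineHom α β P).eval c * (lineHom α β N).eval c) -
      (segmentHom α β c A).coeff k * MvPolynomial.C ((lineHom α β M).eval c) =
    liftResidual α β P Q A N M c k := by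
  have h1 := congrArg (fun G => (segmentHom α β c G).coeff k) h
  simp only [map_mul] at h1
  rw [Polynomial.coeff_mul_mul_eq_add _ _ _ hk,
    Polynomial.coeff_mul_eq_add (segmentHom α β c A)] at h1
  simp only [coeff_zero_segmentHom] at h1
  rw [liftResidual, map_mul, map_mul]
  linear_combination h1

/-- The matrix of the linear system for the order `k` parts of `P`, `Q` and `A`. -/
def liftMatrix (a b m : ℕ) (p₀ q₀ N₀ M₀ : Polynomial F) (c : Fin m → F) :
    Matrix (Fin m) (Fin a ⊕ Fin b ⊕ Fin (a + b)) F :=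
  Matrix.of fun l =>
    Sum.elim (fun i => c l ^ (i : ℕ) * (q₀.eval (c l) * N₀.eval (c l)))
      (Sum.elim (fun i => c l ^ (i : ℕ) * (p₀.eval (c l) * N₀.eval (c l)))
        fun i => -(c l ^ (i : ℕ) * M₀.eval (c l)))

theorem sum_map_liftMatrix_mul {S : Type*} [CommRing S] (φ : F →+* S) {a b m : ℕ}
    (p₀ q₀ N₀ M₀ : Polynomial F) (c : Fin m → F) (x : Fin a → S) (w : Fin b → S)
    (v : Fin (a + b) → S) (l : Fin m) :
    ∑ i, φ (liftMatrix a b m p₀ q₀ N₀ M₀ c l i) * Sum.elim x (Sum.elim w v) i =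
      (∑ i : Fin a, φ (c l) ^ (i : ℕ) * x i) * φ (q₀.eval (c l) * N₀.eval (c l)) +
      (∑ i : Fin b, φ (c l) ^ (i : ℕ) * w i) * φ (p₀.eval (c l) * N₀.eval (c l)) -
      (∑ i : Fin (a + b), φ (c l) ^ (i : ℕ) * v i) * φ (M₀.eval (c l)) := by
  simp only [liftMatrix, Matrix.of_apply, Fintype.sum_sum_type, Sum.elim_inl, Sum.elim_inr]
  rw [Finset.sum_mul, Finset.sum_mul, Finset.sum_mul, add_sub_assoc, sub_eq_add_neg,
    ← Finset.sum_neg_distrib]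
  congr 1
  · refine Finset.sum_congr rfl fun i _ => ?_
    rw [map_mul, map_pow]
    ring
  · congr 1
    · refine Finset.sum_congr rfl fun i _ => ?_
      rw [map_mul, map_pow]
      ring
    · refine Finset.sum_congr rfl fun i _ => ?_
      rw [map_neg, map_mul, map_pow]
      ring

theorem exists_mul_liftMatrix_eq_one {p₀ q₀ A₀ N₀ M₀ : Polynomial F} {a b m : ℕ}
    (hrel : p₀ * q₀ * N₀ = A₀ * M₀) (hpq : IsCoprime p₀ q₀) (hRA : IsCoprime (p₀ * q₀) A₀)
    (hp0 : p₀ ≠ 0) (hq0 : q₀ ≠ 0) (hp : p₀.natDegree = a) (hq : q₀.natDegree = b)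
    (hA : A₀.natDegree < a + b) (c : Fin m → F) (hc : Function.Injective c)
    (hm : 2 * (a + b) ≤ m) (hM : ∀ l, M₀.eval (c l) ≠ 0) :
    ∃ L : Matrix (Fin a ⊕ Fin b ⊕ Fin (a + b)) (Fin m) F,
      L * liftMatrix a b m p₀ q₀ N₀ M₀ c = 1 := by
  refine Matrix.exists_mul_eq_one_of_mulVec_eq_zero _ fun v hv => ?_
  -- A kernel vector is read as three polynomials in `y` of degrees below `a`, `b` and `a + b`.
  let poly (r : ℕ) (w : Fin r → F) : Polynomial F :=
    ∑ i, Polynomial.C (w i) * Polynomial.X ^ (i : ℕ)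
  have hlt : ∀ (r : ℕ) (w : Fin r → F), (poly r w).degree < r := fun r w =>
    Polynomial.degree_sum_fin_lt w
  have hcoeff : ∀ (r : ℕ) (w : Fin r → F), poly r w = 0 → w = 0 := by
    intro r w hw
    funext i
    have := congrArg (fun G => Polynomial.coeff G i) hw
    simp only [poly, Polynomial.finsetSum_coeff, Polynomial.coeff_C_mul, Polynomial.coeff_X_pow,
      Polynomial.coeff_zero] at this
    rw [Finset.sum_eq_single i (fun j _ hj => by rw [if_neg (Fin.val_ne_of_ne hj.symm), mul_zero])
      (fun h => absurd (Finset.mem_univ i) h), if_pos rfl, mul_one] at this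
    exact this
  have heval : ∀ (r : ℕ) (w : Fin r → F) (y : F),
      (poly r w).eval y = ∑ i : Fin r, y ^ (i : ℕ) * w i := by
    intro r w y
    simp only [poly, Polynomial.eval_finsetSum, Polynomial.eval_mul, Polynomial.eval_C,
      Polynomial.eval_pow, Polynomial.eval_X]
    exact Finset.sum_congr rfl fun i _ => mul_comm _ _
  have h0 : p₀ * q₀ ≠ 0 := mul_ne_zero hp0 hq0
  have hdeg : (p₀ * q₀).natDegree = a + b := by rw [Polynomial.natDegree_mul hp0 hq0, hp, hq]
  have hdeg' : (p₀ * q₀).degree = ((a + b : ℕ) : WithBot ℕ) := by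
    rw [Polynomial.degree_eq_natDegree h0, hdeg]
  have hsum : ∀ l, (poly a fun i => v (.inl i)).eval (c l) * (q₀.eval (c l) * N₀.eval (c l)) +
      (poly b fun i => v (.inr (.inl i))).eval (c l) * (p₀.eval (c l) * N₀.eval (c l)) =
      (poly (a + b) fun i => v (.inr (.inr i))).eval (c l) * M₀.eval (c l) := by
    intro l
    have h1 := sum_map_liftMatrix_mul (RingHom.id F) p₀ q₀ N₀ M₀ c (fun i => v (.inl i))
      (fun i => v (.inr (.inl i))) (fun i => v (.inr (.inr i))) l
    have h2 : ∑ i, liftMatrix a b m p₀ q₀ N₀ M₀ c l i * v i = 0 := congrFun hv l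
    simp only [RingHom.id_apply] at h1
    rw [heval, heval, heval, ← sub_eq_zero, ← h1, ← h2]
    refine Finset.sum_congr rfl fun i _ => ?_
    rcases i with i | i | i <;> rfl
  obtain ⟨hx, hw, hv'⟩ := Polynomial.eq_zero_of_eval_mul_eq hrel hpq hRA h0
    (by rw [hdeg']; exact Polynomial.degree_le_natDegree.trans_lt (by exact_mod_cast hA))
    (by rw [Polynomial.degree_eq_natDegree hp0, hp]; exact hlt _ _)
    (by rw [Polynomial.degree_eq_natDegree hq0, hq]; exact hlt _ _)
    (by rw [hdeg']; exact hlt _ _) c hc (by rwa [hdeg]) hM hsum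
  funext i
  rcases i with i | i | i
  · exact congrFun (hcoeff _ _ hx) i
  · exact congrFun (hcoeff _ _ hw) i
  · exact congrFun (hcoeff _ _ hv') i

/-- The matrix depends on the order zero data alone, so a single left inverse provides the scalars
for all orders `k ≠ 0`. -/
theorem exists_lift_coefficients (α β : Fin n → F) {P Q A N M : MvPolynomial (Fin n) F} {a b m : ℕ}
    (hrel : P * Q * N = A * M) (hsep : (lineHom α β (P * Q)).Separable)
    (hP : P.totalDegree ≤ a) (hQ : Q.totalDegree ≤ b)
    (hdeg : (lineHom α β (P * Q)).natDegree = a + b)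
    (hcop : IsCoprime (lineHom α β (P * Q)) (lineHom α β A))
    (hA : A.totalDegree < a + b) (hm : 2 * (a + b) ≤ m) (c : Fin m → F)
    (hc : Function.Injective c) (hM : ∀ l, (lineHom α β M).eval (c l) ≠ 0)
    {G : MvPolynomial (Fin n) F} (hG : G = P ∨ G = Q ∨ G = A) : ∃ L : ℕ → Fin m → F,
      ∀ k ≠ 0, ∀ i, ((homotopyHom α β G).coeff k).coeff i =
        ∑ l, MvPolynomial.C (L i l) * liftResidual α β P Q A N M (c l) k := by
  rw [map_mul] at hsep hdeg hcop
  have h0 := hsep.ne_zero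
  have hp0 := left_ne_zero_of_mul h0
  have hq0 := right_ne_zero_of_mul h0
  have h1 := (natDegree_lineHom_le α β P).trans hP
  have h2 := (natDegree_lineHom_le α β Q).trans hQ
  rw [Polynomial.natDegree_mul hp0 hq0] at hdeg
  have hrel₀ := congrArg (lineHom α β) hrel
  simp only [map_mul] at hrel₀
  obtain ⟨L, hL⟩ := exists_mul_liftMatrix_eq_one hrel₀ hsep.isCoprime hcop hp0 hq0
    (a := a) (b := b) (by omega) (by omega) ((natDegree_lineHom_le α β A).trans_lt hA) c hc hm hM
  -- For `k ≥ 1` the degree in `y` is at most `r - k < r`, so `r` unknowns suffice. This fails at `k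
  -- = 0`.
  have hzero : ∀ (G : MvPolynomial (Fin n) F) (r : ℕ), G.totalDegree ≤ r → ∀ k ≠ 0, ∀ i, r ≤ i →
      ((homotopyHom α β G).coeff k).coeff i = 0 := fun G r hG k hk i hi =>
    natDegree_coeff_homotopyHom α β _ (by omega)
  have hkey : ∀ k ≠ 0, ∀ i, Sum.elim (fun i : Fin a => ((homotopyHom α β P).coeff k).coeff i)
      (Sum.elim (fun i : Fin b => ((homotopyHom α β Q).coeff k).coeff i)
        fun i : Fin (a + b) => ((homotopyHom α β A).coeff k).coeff i) i =
      ∑ l, MvPolynomial.C (L i l) * liftResidual α β P Q A N M (c l) k := by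
    intro k hk
    refine Matrix.eq_sum_of_mul_eq_one MvPolynomial.C hL fun l => ?_
    rw [sum_map_liftMatrix_mul, ← segmentHom_relation α β hrel (c l) hk]
    simp only [coeff_segmentHom]
    rw [Polynomial.eval_eq_sum_fin (hzero P a hP k hk),
      Polynomial.eval_eq_sum_fin (hzero Q b hQ k hk),
      Polynomial.eval_eq_sum_fin (hzero A (a + b) hA.le k hk)]
  rcases hG with rfl | rfl | rfl
  · refine ⟨fun i l => if h : i < a then L (.inl ⟨i, h⟩) l else 0, fun k hk i => ?_⟩
    by_cases h : i < a
    · simp only [dif_pos h]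
      exact hkey k hk (.inl ⟨i, h⟩)
    · simp only [dif_neg h, map_zero, zero_mul, Finset.sum_const_zero]
      exact hzero _ a hP k hk i (not_lt.mp h)
  · refine ⟨fun i l => if h : i < b then L (.inr (.inl ⟨i, h⟩)) l else 0, fun k hk i => ?_⟩
    by_cases h : i < b
    · simp only [dif_pos h]
      exact hkey k hk (.inr (.inl ⟨i, h⟩))
    · simp only [dif_neg h, map_zero, zero_mul, Finset.sum_const_zero]
      exact hzero _ b hQ k hk i (not_lt.mp h)
  · refine ⟨fun i l => if h : i < a + b then L (.inr (.inr ⟨i, h⟩)) l else 0, fun k hk i => ?_⟩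
    by_cases h : i < a + b
    · simp only [dif_pos h]
      exact hkey k hk (.inr (.inr ⟨i, h⟩))
    · simp only [dif_neg h, map_zero, zero_mul, Finset.sum_const_zero]
      exact hzero _ (a + b) hA.le k hk i (not_lt.mp h)

/-! ### The cost of lifting -/

/-- The coefficients of the expansion of `G` up to order `k`. -/
def expansionCoeffs (α β : Fin n → F) (k : ℕ) (G : MvPolynomial (Fin n) F) :
    Set (MvPolynomial (Fin n) F) :=
  {x | ∃ j ≤ k, ∃ i, x = ((homotopyHom α β G).coeff j).coeff i}

/-- The coefficients of the expansions of `G` along the given segments up to order `d`. -/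
def segmentCoeffs (α β : Fin n → F) {m : ℕ} (c : Fin m → F) (d : ℕ) (G : MvPolynomial (Fin n) F) :
    Set (MvPolynomial (Fin n) F) :=
  {x | ∃ j ≤ d, ∃ l, x = (segmentHom α β (c l) G).coeff j}

/-- The cost of computing the order `k` parts from those of lower order, for total degree `d`. -/
def liftStepCost (d m : ℕ) : ℕ :=
  3 * (m * (d + 1) * (5 * (d + 1) + 1)) + m * (d + 1) * (4 * (d + 1) + 1) +
    m * (2 * (4 * (d + 1) + 1) + 11) + 3 * ((d + 2) * (5 * m + 1))

namespace RelCost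

variable {S : Set (MvPolynomial (Fin n) F)}

theorem coeff_segmentHom_of_expansionCoeffs (α β : Fin n → F) (c : F) {d k : ℕ}
    {G : MvPolynomial (Fin n) F} (hG : G.totalDegree ≤ d) (h : expansionCoeffs α β k G ⊆ S)
    {j : ℕ} (hj : j ≤ k) : RelCost S {(segmentHom α β c G).coeff j} (5 * (d + 1) + 1) := by
  have hdeg : ((homotopyHom α β G).coeff j).natDegree < d + 1 := by
    rw [Nat.lt_succ_iff, Polynomial.natDegree_le_iff_coeff_eq_zero]
    exact fun i hi => natDegree_coeff_homotopyHom α β G (by omega)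
  rw [coeff_segmentHom, Polynomial.eval_eq_sum_range' hdeg]
  have := linearCombination (S := S) (Finset.range (d + 1)) (fun i => c ^ i)
    (fun i => ((homotopyHom α β G).coeff j).coeff i) fun i _ => h ⟨j, hj, i, rfl⟩
  simpa [mul_comm] using this

theorem coeff_mul_of_range {P Q : Polynomial (MvPolynomial (Fin n) F)} {k d : ℕ} (hk : k ≤ d)
    (hP : P.coeff '' Finset.range (k + 1) ⊆ S) (hQ : Q.coeff '' Finset.range (k + 1) ⊆ S) :
    RelCost S {(P * Q).coeff k} (4 * (d + 1) + 1) :=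
  coeff_mul hk (fun j hj => hP ⟨j, by simpa [Nat.lt_succ_iff] using hj, rfl⟩)
    fun j hj => hQ ⟨j, by simpa [Nat.lt_succ_iff] using hj, rfl⟩

/-- The parts of order `< k` along all segments, with the part of order `k` replaced by zero. -/
theorem erase_coeffs (α β : Fin n → F) {m : ℕ} (c : Fin m → F) {d k : ℕ}
    {G : MvPolynomial (Fin n) F} (hG : G.totalDegree ≤ d) (hk : k < d)
    (h : expansionCoeffs α β k G ⊆ S) :
    RelCost S (⋃ l, ((segmentHom α β (c l) G).erase (k + 1)).coeff '' Finset.range (k + 2))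
      (m * (d + 1) * (5 * (d + 1) + 1)) := by
  have := biUnion (S := S) (Finset.univ : Finset (Fin m))
    (fun l => ((segmentHom α β (c l) G).erase (k + 1)).coeff '' Finset.range (k + 2))
    (a := (k + 2) * (5 * (d + 1) + 1)) fun l _ => ?_
  · refine this.mono subset_rfl (by simp) ?_
    rw [Finset.card_univ, Fintype.card_fin, mul_assoc]
    exact Nat.mul_le_mul_left _ (Nat.mul_le_mul_right _ (by omega))
  · refine (image (a := 5 * (d + 1) + 1) _ _ fun j hj => ?_).le (by rw [Finset.card_range])
    rw [Polynomial.coeff_erase]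
    split_ifs with hjk
    · rw [← MvPolynomial.C_0]
      exact (const 0).le (by omega)
    · refine coeff_segmentHom_of_expansionCoeffs α β _ hG h ?_
      have : j < k + 2 := by simpa using hj
      omega

theorem range_liftResidual (α β : Fin n → F) {P Q A N M : MvPolynomial (Fin n) F} {d k m : ℕ}
    (c : Fin m → F) (hP : P.totalDegree ≤ d) (hQ : Q.totalDegree ≤ d) (hA : A.totalDegree ≤ d)
    (hk : k < d) (hPS : expansionCoeffs α β k P ⊆ S) (hQS : expansionCoeffs α β k Q ⊆ S)
    (hAS : expansionCoeffs α β k A ⊆ S) (hN : segmentCoeffs α β c d N ⊆ S)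
    (hM : segmentCoeffs α β c d M ⊆ S) :
    RelCost S (Set.range fun l => liftResidual α β P Q A N M (c l) (k + 1))
      (3 * (m * (d + 1) * (5 * (d + 1) + 1)) + m * (d + 1) * (4 * (d + 1) + 1) +
        m * (2 * (4 * (d + 1) + 1) + 11)) := by
  let E : MvPolynomial (Fin n) F → Fin m → Polynomial (MvPolynomial (Fin n) F) := fun G l =>
    (segmentHom α β (c l) G).erase (k + 1)
  let U : (Fin m → Polynomial (MvPolynomial (Fin n) F)) → Set (MvPolynomial (Fin n) F) := fun f =>
    ⋃ l, (f l).coeff '' Finset.range (k + 2)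
  have hU : ∀ f l, (f l).coeff '' Finset.range (k + 2) ⊆ U f := fun f l =>
    Set.subset_iUnion (fun l => (f l).coeff '' Finset.range (k + 2)) l
  have hseg : ∀ G l, segmentCoeffs α β c d G ⊆ S →
      (segmentHom α β (c l) G).coeff '' Finset.range (k + 2) ⊆ S := by
    rintro G l hG _ ⟨j, hj, rfl⟩
    have : j < k + 2 := by simpa using hj
    exact hG ⟨j, by omega, l, rfl⟩
  have h1 : RelCost S (U (E P) ∪ U (E Q) ∪ U (E A)) (m * (d + 1) * (5 * (d + 1) + 1) +
      m * (d + 1) * (5 * (d + 1) + 1) + m * (d + 1) * (5 * (d + 1) + 1)) :=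
    ((erase_coeffs α β c hP hk hPS).union (erase_coeffs α β c hQ hk hQS)).union
      (erase_coeffs α β c hA hk hAS)
  -- The product of the two erased expansions is stored at every order up to `k + 1`, so that
  -- multiplying by the expansion of `N` is one more convolution.
  have h2 : RelCost (S ∪ (U (E P) ∪ U (E Q) ∪ U (E A))) (U fun l => E P l * E Q l)
      (m * (d + 1) * (4 * (d + 1) + 1)) := by
    have := biUnion (S := S ∪ (U (E P) ∪ U (E Q) ∪ U (E A))) (Finset.univ : Finset (Fin m))
      (fun l => (E P l * E Q l).coeff '' Finset.range (k + 2))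
      (a := (k + 2) * (4 * (d + 1) + 1)) fun l _ => ?_
    · refine this.mono subset_rfl (by simp [U]) ?_
      rw [Finset.card_univ, Fintype.card_fin, mul_assoc]
      exact Nat.mul_le_mul_left _ (Nat.mul_le_mul_right _ (by omega))
    · refine (image (a := 4 * (d + 1) + 1) _ _ fun j hj => ?_).le (by rw [Finset.card_range])
      have hj' : j < k + 2 := by simpa using hj
      refine coeff_mul (by omega) (fun i hi => ?_) fun i hi => ?_
      · exact Or.inr (Or.inl (Or.inl (hU (E P) l ⟨i, by simpa using by omega, rfl⟩)))
      · exact Or.inr (Or.inl (Or.inr (hU (E Q) l ⟨i, by simpa using by omega, rfl⟩)))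
  have h3 := h1.trans h2
  have h4 := image (S := S ∪ (U (E P) ∪ U (E Q) ∪ U (E A) ∪ U fun l => E P l * E Q l))
      (Finset.univ : Finset (Fin m)) (fun l => liftResidual α β P Q A N M (c l) (k + 1))
      (a := 2 * (4 * (d + 1) + 1) + 11) fun l _ => ?_
  · refine (h3.comp h4).mono subset_rfl (by simp) ?_
    rw [Finset.card_univ, Fintype.card_fin]
    exact le_of_eq (by ring)
  · have h5 : RelCost (S ∪ (U (E P) ∪ U (E Q) ∪ U (E A) ∪ U fun l => E P l * E Q l))
        {(E A l * segmentHom α β (c l) M).coeff (k + 1)} (4 * (d + 1) + 1) :=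
      coeff_mul_of_range hk
        ((hU (E A) l).trans fun x hx => Or.inr (Or.inl (Or.inr hx)))
        ((hseg M l hM).trans Set.subset_union_left)
    have h6 : RelCost (S ∪ (U (E P) ∪ U (E Q) ∪ U (E A) ∪ U fun l => E P l * E Q l))
        {(E P l * E Q l * segmentHom α β (c l) N).coeff (k + 1)} (4 * (d + 1) + 1) :=
      coeff_mul_of_range hk
        ((hU (fun l => E P l * E Q l) l).trans fun x hx => Or.inr (Or.inr hx))
        ((hseg N l hN).trans Set.subset_union_left)
    exact ((h5.union h6).comp (sub (Or.inr (Or.inl rfl)) (Or.inr (Or.inr rfl)))).le (by omega)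

theorem expansionCoeffs_succ (α β : Fin n → F) {G : MvPolynomial (Fin n) F} {d k m : ℕ}
    (hG : G.totalDegree ≤ d) (r : Fin m → MvPolynomial (Fin n) F) (L : ℕ → Fin m → F)
    (hL : ∀ i, ((homotopyHom α β G).coeff (k + 1)).coeff i = ∑ l, MvPolynomial.C (L i l) * r l)
    (hS : expansionCoeffs α β k G ⊆ S) (hr : Set.range r ⊆ S) :
    RelCost S (expansionCoeffs α β (k + 1) G) ((d + 2) * (5 * m + 1)) := by
  have h := image (S := S) (Finset.range (d + 2))
    (fun i => ((homotopyHom α β G).coeff (k + 1)).coeff i) (a := 5 * m + 1) fun i _ => ?_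
  · refine ((of_subset hS).union h).mono subset_rfl ?_ (by simp)
    rintro _ ⟨j, hj, i, rfl⟩
    rcases Nat.le_succ_iff.mp hj with hj | rfl
    · exact Or.inl ⟨j, hj, i, rfl⟩
    · right
      by_cases hi : i < d + 2
      · exact ⟨i, by simpa using hi, rfl⟩
      -- The coefficient at `d + 1` is zero and stands for all higher ones; this is why `d + 2`
      -- indices are computed.
      · refine ⟨d + 1, by simp, ?_⟩
        dsimp only
        rw [natDegree_coeff_homotopyHom α β G (by omega),
          natDegree_coeff_homotopyHom α β G (by omega)]
  · rw [hL]
    simpa using linearCombination (S := S) Finset.univ (L i) r fun l _ => hr ⟨l, rfl⟩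

theorem expansionCoeffs_zero (α β : Fin n → F) {G : MvPolynomial (Fin n) F} {d : ℕ}
    (hG : G.totalDegree ≤ d) : RelCost S (expansionCoeffs α β 0 G) (d + 2) := by
  have h := image (S := S) (Finset.range (d + 2))
    (fun i => ((homotopyHom α β G).coeff 0).coeff i) (a := 1) fun i _ => ?_
  · refine h.mono subset_rfl ?_ (by simp)
    rintro _ ⟨j, hj, i, rfl⟩
    obtain rfl := Nat.le_zero.mp hj
    by_cases hi : i < d + 2
    · exact ⟨i, by simpa using hi, rfl⟩
    · refine ⟨d + 1, by simp, ?_⟩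
      dsimp only
      rw [natDegree_coeff_homotopyHom α β G (by omega),
        natDegree_coeff_homotopyHom α β G (by omega)]
  · rw [coeff_zero_homotopyHom, Polynomial.coeff_map]
    exact const _

/-- All earlier orders stay stored, so each further order adds a fixed `liftStepCost` and the total
is linear in `k`. -/
theorem expansionCoeffs_lift (α β : Fin n → F) {P Q A N M : MvPolynomial (Fin n) F} {d m : ℕ}
    (c : Fin m → F) (hP : P.totalDegree ≤ d) (hQ : Q.totalDegree ≤ d) (hA : A.totalDegree ≤ d)
    (hL : ∀ G, (G = P ∨ G = Q ∨ G = A) → ∃ L : ℕ → Fin m → F,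
      ∀ k ≠ 0, ∀ i, ((homotopyHom α β G).coeff k).coeff i =
        ∑ l, MvPolynomial.C (L i l) * liftResidual α β P Q A N M (c l) k)
    (k : ℕ) (hk : k ≤ d) :
    RelCost (segmentCoeffs α β c d N ∪ segmentCoeffs α β c d M)
      (expansionCoeffs α β k P ∪ expansionCoeffs α β k Q ∪ expansionCoeffs α β k A)
      (3 * (d + 2) + k * liftStepCost d m) := by
  obtain ⟨LP, hLP⟩ := hL P (by simp)
  obtain ⟨LQ, hLQ⟩ := hL Q (by simp)
  obtain ⟨LA, hLA⟩ := hL A (by simp)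
  induction k with
  | zero =>
    exact (((expansionCoeffs_zero α β hP).union (expansionCoeffs_zero α β hQ)).union
      (expansionCoeffs_zero α β hA)).le (by omega)
  | succ k ih =>
    set W := segmentCoeffs α β c d N ∪ segmentCoeffs α β c d M
    set V := expansionCoeffs α β k P ∪ expansionCoeffs α β k Q ∪ expansionCoeffs α β k A
    have hVP : expansionCoeffs α β k P ⊆ V := fun x hx => Or.inl (Or.inl hx)
    have hVQ : expansionCoeffs α β k Q ⊆ V := fun x hx => Or.inl (Or.inr hx)
    have hVA : expansionCoeffs α β k A ⊆ V := fun x hx => Or.inr hx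
    have h1 := range_liftResidual (S := W ∪ V) (N := N) (M := M) α β c hP hQ hA hk
      (hVP.trans Set.subset_union_right)
      (hVQ.trans Set.subset_union_right) (hVA.trans Set.subset_union_right)
      (fun x hx => Or.inl (Or.inl hx)) (fun x hx => Or.inl (Or.inr hx))
    set r := fun l => liftResidual α β P Q A N M (c l) (k + 1)
    have hV : V ⊆ W ∪ V ∪ Set.range r := fun x hx => Or.inl (Or.inr hx)
    have h2 := ((expansionCoeffs_succ (S := W ∪ V ∪ Set.range r) α β hP r LP
      (hLP (k + 1) (Nat.succ_ne_zero k)) (hVP.trans hV) Set.subset_union_right).union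
      (expansionCoeffs_succ (S := W ∪ V ∪ Set.range r) α β hQ r LQ
      (hLQ (k + 1) (Nat.succ_ne_zero k)) (hVQ.trans hV) Set.subset_union_right)).union
      (expansionCoeffs_succ (S := W ∪ V ∪ Set.range r) α β hA r LA
      (hLA (k + 1) (Nat.succ_ne_zero k)) (hVA.trans hV) Set.subset_union_right)
    refine ((ih (by omega)).comp (h1.comp h2)).le ?_
    rw [liftStepCost]
    exact le_of_eq (by ring)

theorem of_expansionCoeffs (α β : Fin n → F) {P : MvPolynomial (Fin n) F} {d : ℕ}
    (hP : P.totalDegree ≤ d) (h : expansionCoeffs α β d P ⊆ S) : RelCost S {P} (d + 2) := by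
  have := sum (S := S) (Finset.range (d + 1))
    (fun k => ((homotopyHom α β P).coeff k).coeff 0) fun k hk =>
      h ⟨k, by simpa [Nat.lt_succ_iff] using hk, 0, rfl⟩
  rw [sum_coeff_homotopyHom α β P hP] at this
  exact this.le (by simp; omega)

end RelCost

/-! ### Computing the irreducible factors -/

theorem MvPolynomial.totalDegree_pos_of_irreducible {p : MvPolynomial (Fin n) F}
    (hp : Irreducible p) : 0 < p.totalDegree := by
  rw [Nat.pos_iff_ne_zero]
  intro h
  rw [MvPolynomial.totalDegree_eq_zero_iff_eq_C] at h
  refine hp.not_isUnit ?_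
  rw [h]
  refine (isUnit_iff_ne_zero.mpr fun h0 => hp.ne_zero ?_).map MvPolynomial.C
  rw [h, h0, map_zero]

theorem MvPolynomial.card_le_totalDegree_prod (s : Finset (MvPolynomial (Fin n) F))
    (hs : ∀ p ∈ s, Irreducible p) : s.card ≤ (∏ p ∈ s, p).totalDegree := by
  classical
  induction s using Finset.induction_on with
  | empty => simp
  | insert p s hp ih =>
    have hs' : ∀ q ∈ s, Irreducible q := fun q hq => hs q (by simp [hq])
    rw [Finset.prod_insert hp, Finset.card_insert_of_notMem hp,
      totalDegree_mul_of_isDomain (hs p (by simp)).ne_zero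
        (Finset.prod_ne_zero_iff.mpr fun q hq => (hs' q hq).ne_zero)]
    have := totalDegree_pos_of_irreducible (hs p (by simp))
    have := ih hs'
    omega

theorem Polynomial.exists_injective_eval_ne_zero [Infinite F] {G : Polynomial F} (hG : G ≠ 0)
    (m : ℕ) : ∃ c : Fin m → F, Function.Injective c ∧ ∀ l, G.eval (c l) ≠ 0 := by
  have hinf : {y : F | G.eval y ≠ 0}.Infinite := by
    intro hfin
    have h : Set.univ ⊆ {y : F | G.eval y ≠ 0} ∪ {y | G.IsRoot y} := fun y _ => by
      by_cases hy : G.eval y = 0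
      · exact Or.inr hy
      · exact Or.inl hy
    exact Set.infinite_univ ((hfin.union (finite_setOfPred_isRoot hG)).subset h)
  refine ⟨fun l => hinf.natEmbedding _ l, fun i j hij => ?_, fun l => (hinf.natEmbedding _ l).2⟩
  exact Fin.val_injective ((hinf.natEmbedding _).injective (Subtype.val_injective hij))

/-- The cost of computing an irreducible factor. -/
def factorCost (d s : ℕ) : ℕ :=
  2 * d * ((d + 1) * (4 * (d + 1) + 11) * (24 * s + 20)) +
    (3 * (d + 2) + d * liftStepCost d (2 * d)) + (d + 2)

/-- The two polynomials are numerator and denominator of the logarithmic derivative of `f / u`,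
obtained from `f` and `u` without division. -/
theorem RelCost.segmentCoeffs_wronskian (α β : Fin n → F) {m s : ℕ} (c : Fin m → F) (d : ℕ)
    {f u : MvPolynomial (Fin n) F} (hf : circuitSize f ≤ s) (hu : circuitSize u ≤ s) :
    RelCost ∅ (segmentCoeffs α β c d (dirDeriv α f * u - f * dirDeriv α u) ∪
      segmentCoeffs α β c d (f * u)) (m * ((d + 1) * (4 * (d + 1) + 11) * (24 * s + 20))) := by
  have h1 := (derivation α hf).union (derivation α hu)
  have h2 : RelCost (∅ ∪ ({f, dirDeriv α f} ∪ {u, dirDeriv α u}))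
      {dirDeriv α f * u - f * dirDeriv α u} (3 + 3 + 11) :=
    ((mul (by simp) (by simp)).union (mul (by simp) (by simp))).comp
      (sub (Or.inr (Or.inl rfl)) (Or.inr (Or.inr rfl)))
  have h3 : RelCost (∅ ∪ ({f, dirDeriv α f} ∪ {u, dirDeriv α u})) {f * u} 3 :=
    mul (by simp) (by simp)
  -- `12 s` for each polynomial with its derivative, `17` for the numerator and `3` for the
  -- denominator.
  have h4 : RelCost ∅ {dirDeriv α f * u - f * dirDeriv α u, f * u} (24 * s + 20) :=
    (h1.comp (h2.union h3)).le (by omega)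
  have h5 := biUnion (Finset.univ : Finset (Fin m)) _ fun l _ => coeffs_segmentHom α β (c l) d h4
  rw [Finset.card_univ, Fintype.card_fin] at h5
  refine h5.mono subset_rfl ?_ le_rfl
  rintro x (⟨j, hj, l, rfl⟩ | ⟨j, hj, l, rfl⟩)
  all_goals
    simp only [Set.mem_iUnion]
    refine ⟨l, Finset.mem_univ l, _, ?_, ⟨j, by simpa [Nat.lt_succ_iff] using hj, rfl⟩⟩
    simp

theorem RelCost.irreducible_factor [IsAlgClosed F] [CharZero F]
    (S : Finset (MvPolynomial (Fin n) F)) (hirr : ∀ p ∈ S, Irreducible p)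
    (hne : ∀ p ∈ S, ∀ q ∈ S, p ∣ q → p = q) (e : MvPolynomial (Fin n) F → ℕ)
    (he : ∀ p ∈ S, e p ≠ 0) {γ : F} (hγ : γ ≠ 0) {f u : MvPolynomial (Fin n) F} (hu : u ≠ 0)
    (hf : f = u * (MvPolynomial.C γ * ∏ p ∈ S, p ^ e p)) {s : ℕ} (hfs : circuitSize f ≤ s)
    (hus : circuitSize u ≤ s) {P : MvPolynomial (Fin n) F} (hP : P ∈ S) :
    RelCost ∅ {P} (factorCost (∏ p ∈ S, p).totalDegree s) := by
  classical
  set R := ∏ p ∈ S, p with hR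
  set d := R.totalDegree with hd
  set v := ∏ p ∈ S, p ^ e p with hv
  have hR0 : R ≠ 0 := Finset.prod_ne_zero_iff.mpr fun p hp => (hirr p hp).ne_zero
  have hv0 : v ≠ 0 := Finset.prod_ne_zero_iff.mpr fun p hp => pow_ne_zero _ (hirr p hp).ne_zero
  obtain ⟨Q, hPQ⟩ : P ∣ R := Finset.dvd_prod_of_mem _ hP
  have hdPQ : d = P.totalDegree + Q.totalDegree := by
    rw [hd, hPQ, MvPolynomial.totalDegree_mul_of_isDomain]
    · exact left_ne_zero_of_mul (hPQ ▸ hR0)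
    · exact right_ne_zero_of_mul (hPQ ▸ hR0)
  have hdpos : 0 < d := by
    have := MvPolynomial.totalDegree_pos_of_irreducible (hirr P hP)
    omega
  have hf0 : f ≠ 0 := by
    rw [hf]
    exact mul_ne_zero hu (mul_ne_zero (MvPolynomial.C_ne_zero.mpr hγ) hv0)
  -- The top form of `R` is nonzero at `α`, so `R` keeps degree `d` on every line in this direction.
  obtain ⟨α, hα⟩ := MvPolynomial.exists_eval_ne_zero
    (MvPolynomial.homogeneousComponent_totalDegree_ne_zero hR0)
  obtain ⟨δ, hδ, hsep⟩ := exists_ne_zero_forall_separable_lineHom S hirr hne α d (by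
    rw [coeff_lineHom _ _ _ le_rfl]
    exact (isUnit_iff_ne_zero.mpr hα).map _)
  -- `δ` ensures separability of `R` on the line; the factors `f` and `u` ensure that `f * u` does
  -- not vanish identically there.
  obtain ⟨β, hβ⟩ := MvPolynomial.exists_eval_ne_zero (mul_ne_zero hδ (mul_ne_zero hf0 hu))
  rw [map_mul] at hβ
  have hsepR := hsep β (left_ne_zero_of_mul hβ)
  obtain ⟨A, hA, hz⟩ := exists_logDeriv_numerator (dirDeriv α) S e he
  have hdegA : A.totalDegree < d := totalDegree_logDeriv_numerator_lt α hv0 hdpos hA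
  -- Writing `f = u γ v`, the Wronskian is `u² γ D v` and `f u = u² γ v`, so this is `hA` multiplied
  -- by `u² γ`.
  have hrel : P * Q * (dirDeriv α f * u - f * dirDeriv α u) = A * (f * u) := by
    rw [← hPQ, hf, Derivation.leibniz, Derivation.leibniz, dirDeriv_C]
    simp only [smul_eq_mul]
    linear_combination (u ^ 2 * MvPolynomial.C γ) * hA
  -- Over the algebraically closed `F`, failure of coprimality gives a point of the line where `R`
  -- and `A` vanish. Then `D R` vanishes too, making it a multiple root of the restricted `R`.
  have hcop : IsCoprime (lineHom α β (P * Q)) (lineHom α β A) := by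
    rw [← hPQ, Polynomial.isCoprime_iff_aeval_ne_zero_of_isAlgClosed F F]
    intro y
    by_contra! hcon
    simp only [Polynomial.coe_aeval_eq_eval] at hcon
    rw [eval_lineHom, eval_lineHom] at hcon
    have h1 := hz _ hcon.1 hcon.2
    have h2 : (lineHom α β (dirDeriv α R)).eval y = 0 := by
      rw [eval_lineHom]
      exact h1
    rw [← derivative_lineHom] at h2
    refine hsepR.eval₂_derivative_ne_zero (RingHom.id F) (x := y) ?_ ?_
    · rw [Polynomial.eval₂_id, eval_lineHom]
      exact hcon.1
    · rwa [Polynomial.eval₂_id]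
  have hM0 : lineHom α β (f * u) ≠ 0 := by
    intro h
    have h1 := eval_zero_lineHom α β (f * u)
    rw [h, Polynomial.eval_zero] at h1
    exact right_ne_zero_of_mul hβ h1.symm
  obtain ⟨c, hc, hcM⟩ := Polynomial.exists_injective_eval_ne_zero hM0 (2 * d)
  have hdeg : (lineHom α β (P * Q)).natDegree = P.totalDegree + Q.totalDegree := by
    rw [← hPQ, ← hdPQ]
    refine le_antisymm (natDegree_lineHom_le α β R) (Polynomial.le_natDegree_of_ne_zero ?_)
    rw [coeff_lineHom _ _ _ le_rfl]
    exact hα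
  have hL := fun G hG => exists_lift_coefficients α β (G := G) hrel (hPQ ▸ hsepR) le_rfl le_rfl hdeg
    hcop (hdPQ ▸ hdegA) (by rw [hdPQ]) c hc hcM hG
  have h1 := RelCost.expansionCoeffs_lift α β c (by omega) (by omega) hdegA.le hL d le_rfl
  have h2 := RelCost.segmentCoeffs_wronskian α β c d hfs hus
  set W := segmentCoeffs α β c d (dirDeriv α f * u - f * dirDeriv α u) ∪
    segmentCoeffs α β c d (f * u)
  have h3 := RelCost.of_expansionCoeffs (S := W ∪ (expansionCoeffs α β d P ∪
    expansionCoeffs α β d Q ∪ expansionCoeffs α β d A)) α β (P := P) (d := d) (by omega)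
    fun x hx => Or.inr (Or.inl (Or.inl hx))
  refine (h2.comp ((h1.comp h3).mono Set.subset_union_right subset_rfl le_rfl)).le ?_
  rw [factorCost]
  omega

/-! ### Arbitrary factors and the polynomial bound -/

/-- The cost of computing an arbitrary factor. -/
def divisorCost (d s : ℕ) : ℕ :=
  d * factorCost d s + d * (6 * (s + 1) + 1) + (d + 5)

/-- There are at most `deg (polyRad u₁)` irreducible factors. Each is computed separately, using the
exponents `e` of `u₁`, and then raised to its exponent `a` in `g`. -/
theorem RelCost.divisor [IsAlgClosed F] [CharZero F] {f u₀ u₁ g : MvPolynomial (Fin n) F}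
    (hf0 : f ≠ 0) (hf : f = u₀ * u₁) {s : ℕ} (hfs : circuitSize f ≤ s) (hus : circuitSize u₀ ≤ s)
    (hg : g ∣ u₁) : RelCost ∅ {g} (divisorCost (polyRad u₁).totalDegree s) := by
  have hu₀ : u₀ ≠ 0 := left_ne_zero_of_mul (hf ▸ hf0)
  have hu₁ : u₁ ≠ 0 := right_ne_zero_of_mul (hf ▸ hf0)
  obtain ⟨S, hrad, hirr, hne, hdvd, hfac⟩ := exists_polyRad_factorization u₁ hu₁
  obtain ⟨e, γ, hγ, he, hu⟩ := hfac u₁ dvd_rfl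
  obtain ⟨a, c, hc, -, hga⟩ := hfac g hg
  rw [hrad]
  have hcard : S.card ≤ (∏ p ∈ S, p).totalDegree := MvPolynomial.card_le_totalDegree_prod S hirr
  -- `p ^ a p` divides `f`, so its exponent is at most `deg f ≤ 2 ^ s`.
  have hexp : ∀ p ∈ S, a p < 2 ^ (s + 1) := by
    intro p hp
    have h1 : p ^ a p ∣ f := by
      rw [hf]
      refine ((Finset.dvd_prod_of_mem (fun p => p ^ a p) hp).trans ?_).trans
        (hg.trans (dvd_mul_left u₁ u₀))
      rw [hga]
      exact dvd_mul_left _ _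
    have h2 := MvPolynomial.totalDegree_le_of_dvd_of_isDomain h1 hf0
    have h3 : a p ≤ (p ^ a p).totalDegree := by
      have := MvPolynomial.totalDegree_pos_of_irreducible (hirr p hp)
      generalize a p = k
      induction k with
      | zero => simp
      | succ k ih =>
        rw [pow_succ, MvPolynomial.totalDegree_mul_of_isDomain
          (pow_ne_zero _ (hirr p hp).ne_zero) (hirr p hp).ne_zero]
        omega
    calc a p ≤ 2 ^ circuitSize f := (h3.trans h2).trans (totalDegree_le_two_pow_circuitSize f)
      _ ≤ 2 ^ s := Nat.pow_le_pow_right (by norm_num) hfs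
      _ < 2 ^ (s + 1) := Nat.pow_lt_pow_right (by norm_num) (by omega)
  have h1 := image (S := ∅) S (fun p => p) fun p hp =>
    irreducible_factor S hirr hne e (fun p hp => he p hp (hdvd p hp)) hγ hu₀ (hf.trans (hu ▸ rfl))
      hfs hus hp
  have h2 := image (S := ∅ ∪ (fun p => p) '' (S : Set (MvPolynomial (Fin n) F))) S
    (fun p => p ^ a p) fun p hp => pow p (s + 1) (a p) (hexp p hp) (Or.inr ⟨p, hp, rfl⟩)
  have h3 := (h1.comp h2).comp (prod S (fun p => p ^ a p) fun p hp => Or.inr ⟨p, hp, rfl⟩)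
  have h4 : RelCost ∅ {g} _ := (h3.union (const c)).comp (hga ▸ mul_comm _ (MvPolynomial.C c) ▸
    mul (Or.inr (Or.inl rfl)) (Or.inr (Or.inr rfl)))
  refine h4.le ?_
  rw [divisorCost]
  have := Nat.mul_le_mul_right (factorCost (∏ p ∈ S, p).totalDegree s) hcard
  have := Nat.mul_le_mul_right (6 * (s + 1) + 1) hcard
  omega

theorem liftStepCost_mono {d d' m m' : ℕ} (hd : d ≤ d') (hm : m ≤ m') :
    liftStepCost d m ≤ liftStepCost d' m' := by
  unfold liftStepCost
  gcongr

theorem divisorCost_mono {d d' s s' : ℕ} (hd : d ≤ d') (hs : s ≤ s') :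
    divisorCost d s ≤ divisorCost d' s' := by
  have := liftStepCost_mono hd (Nat.mul_le_mul_left 2 hd)
  unfold divisorCost factorCost
  gcongr

open Polynomial in
theorem exists_polynomial_eval_eq_divisorCost :
    ∃ P : Polynomial ℕ, ∀ x, P.eval x = divisorCost x x := by
  let L : Polynomial ℕ := 3 * (2 * X * (X + 1) * (5 * (X + 1) + 1)) +
    2 * X * (X + 1) * (4 * (X + 1) + 1) + 2 * X * (2 * (4 * (X + 1) + 1) + 11) +
    3 * ((X + 2) * (5 * (2 * X) + 1))
  refine ⟨X * (2 * X * ((X + 1) * (4 * (X + 1) + 11) * (24 * X + 20)) +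
    (3 * (X + 2) + X * L) + (X + 2)) + X * (6 * (X + 1) + 1) + (X + 5), fun x => ?_⟩
  simp [L, divisorCost, factorCost, liftStepCost]

end

theorem theorem1 :
    ∃ P : Polynomial ℕ,
      ∀ (F : Type*) [Field F] [IsAlgClosed F] [CharZero F] (n s : ℕ)
        (f u₀ u₁ : MvPolynomial (Fin n) F),
        f ≠ 0 → f = u₀ * u₁ → circuitSize f + circuitSize u₀ ≤ s →
          ∀ g : MvPolynomial (Fin n) F, g ∣ u₁ →
            ∃ C : AlgCircuit F n,
              C.eval = g ∧ C.size ≤ P.eval (s + (polyRad u₁).totalDegree) := by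
  obtain ⟨P, hP⟩ := exists_polynomial_eval_eq_divisorCost
  refine ⟨P, fun F _ _ _ n s f u₀ u₁ hf0 hf hs g hg => ?_⟩
  rw [hP]
  exact ((RelCost.divisor (s := s) hf0 hf (by omega) (by omega) hg).le
    (divisorCost_mono (by omega) (by omega))).exists_circuit
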